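/- All graphs are simple. Let $G$ be an infinite, locally finite graph that is 2-connected, that is, $G-v$ is connected for every vertex $v$. Then $G$ contains as an induced subgraph an infinite messy ladder or a member of one of the families $\mathscr L_\infty$, $\mathscr L^{\Delta}_\infty$, $\mathscr L^{\nabla\Delta}_\infty$, which are defined as follows. A ray is a sequence $r_0,r_1,r_2,\dots$ of distinct vertices with $r_ir_{i+1}$ an edge for every $i$; its initial vertex is $r_0$, and it is induced in a graph if no other pair of its vertices is adjacent there. Two rays are in the same end of a graph if the graph contains infinitely many pairwise disjoint paths, each joining a vertex of one ray to a vertex of the other. An infinite messy ladder is a locally finite graph $L$ having two disjoint rays $W$ and $X$, induced in $L$ and in the same end of $L$, such that every vertex of $L$ lies on $W$ or $X$ and the initial vertices of $W$ and $X$ are adjacent. Let $P$ and $Q$ be disjoint induced rays in a graph $L$. A tie of $P\cup Q$ is a component $J$ of $L\setminus E(P\cup Q)$ (edges are deleted, all vertices are kept) that meets both $P$ and $Q$; its vertices of attachment are its vertices on $P\cup Q$. A tie $J$ is * of type $I$ if it has exactly one vertex of attachment $p$ on $P$ and exactly one, $q$, on $Q$, and $J$ is a path from $p$ to $q$; * of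 type $Y$ if its vertices of attachment are two consecutive vertices $p,p'$ of $P$ and one vertex $q$ of $Q$, and $J$ consists of a path avoiding $p,p'$ from a vertex $u$ not on $P\cup Q$ to $q$, together with the vertices $p,p'$ and the edges $up,up'$; * of type $\lambda$ if it is of type $Y$ with the roles of $P$ and $Q$ exchanged; * of type $Y\text{-}\lambda$ if its vertices of attachment are two consecutive vertices $p,p'$ of $P$ and two consecutive vertices $q,q'$ of $Q$, and $J$ consists of a path, disjoint from $P\cup Q$, from a vertex $u$ to a vertex $v$ (possibly $u=v$), together with the vertices $p,p',q,q'$ and the edges $up,up',vq,vq'$. Two ties cross if all vertices of attachment of one strictly precede those of the other on $P$, while the order on $Q$ is reversed. For a tie type $\tau$, call $L$ a $\tau$-ladder if it has disjoint induced rays $P,Q$ such that: every vertex and every edge of $L$ that is not in $P\cup Q$ lies in a tie of $P\cup Q$; every tie is of type $\tau$; there are infinitely many ties; no two of them cross; and some tie contains the initial vertices of both $P$ and $Q$. Then $\mathscr L_\infty$ is the family of all $I$-ladders, $\mathscr L^{\Delta}_\infty$ is the family of all $Y$-ladders and all $\lambda$-ladders, and $\mathscr L^{\nabla\Delta}_\infty$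 is the family of all $Y\text{-}\lambda$-ladders. -/

import Mathlib

open Set

namespace LadderLemma

variable {V : Type*}

/-- Every vertex has only finitely many neighbours. -/
def IsLocallyFinite (G : SimpleGraph V) : Prop :=
  ∀ v : V, (G.neighborSet v).Finite

/-- 2-connectedness of an infinite graph: deleting any one vertex leaves a connected graph. -/
def IsTwoConnected (G : SimpleGraph V) : Prop :=
  ∀ v : V, (G.induce ({v}ᶜ : Set V)).Connected

/-- `r 0, r 1, r 2, …` is a ray of `G` with initial vertex `r 0`. -/
def IsRay (G : SimpleGraph V) (r : ℕ → V) : Prop :=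
  Function.Injective r ∧ ∀ i, G.Adj (r i) (r (i + 1))

/-- A ray whose only edges in `G` are those joining consecutive vertices. -/
def IsInducedRay (G : SimpleGraph V) (r : ℕ → V) : Prop :=
  IsRay G r ∧ ∀ i j, G.Adj (r i) (r j) → j = i + 1 ∨ i = j + 1

/-- The rays `P` and `Q` belong to the same end of `G`: there are infinitely many pairwise
disjoint paths of `G`, each joining a vertex of `P` to a vertex of `Q`. -/
def SameEnd (G : SimpleGraph V) (P Q : ℕ → V) : Prop :=
  ∃ (a b : ℕ → V) (A : ∀ n, G.Walk (a n) (b n)),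
    (∀ n, (A n).IsPath ∧ a n ∈ range P ∧ b n ∈ range Q) ∧
    ∀ m n, m ≠ n → (A m).support.Disjoint (A n).support

/-- An infinite messy ladder with rails `W` and `X`. -/
def IsMessyLadderWith (L : SimpleGraph V) (W X : ℕ → V) : Prop :=
  IsLocallyFinite L ∧
  IsInducedRay L W ∧ IsInducedRay L X ∧
  Disjoint (range W) (range X) ∧
  range W ∪ range X = univ ∧
  SameEnd L W X ∧
  L.Adj (W 0) (X 0)

/-- `L` is an infinite messy ladder. -/
def IsMessyLadder (L : SimpleGraph V) : Prop :=
  ∃ W X : ℕ → V, IsMessyLadderWith L W X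

/-- The edges of the ray `r`. -/
def rayEdges (r : ℕ → V) : Set (Sym2 V) :=
  range fun i => s(r i, r (i + 1))

/-- The graph `G ∖ E(P ∪ Q)`; all vertices are kept. -/
def offRails (G : SimpleGraph V) (P Q : ℕ → V) : SimpleGraph V :=
  G.deleteEdges (rayEdges P ∪ rayEdges Q)

/-- `J` is (the vertex set of) a tie of `P ∪ Q`: a component of `G ∖ E(P ∪ Q)` that meets both
`P` and `Q`. The edges of the tie are the edges of `offRails G P Q` with ends in `J`. -/
def IsTie (G : SimpleGraph V) (P Q : ℕ → V) (J : Set V) : Prop :=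
  (∃ c : (offRails G P Q).ConnectedComponent, c.supp = J) ∧
  (J ∩ range P).Nonempty ∧ (J ∩ range Q).Nonempty

/-- The tie `J` is of type `I`: it has one vertex of attachment on each ray, and it is a path
joining these two vertices. -/
def IsTypeI (G : SimpleGraph V) (P Q : ℕ → V) (J : Set V) : Prop :=
  ∃ (i j : ℕ) (w : (offRails G P Q).Walk (P i) (Q j)),
    w.IsPath ∧
    J ∩ range P = {P i} ∧ J ∩ range Q = {Q j} ∧
    J = {x | x ∈ w.support} ∧
    ∀ x ∈ J, ∀ y ∈ J, (offRails G P Q).Adj x y → s(x, y) ∈ w.edges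

/-- The tie `J` is of type `Y`: its vertices of attachment are two consecutive vertices of `P` and
one vertex `q` of `Q`, and `J` consists of a path from a vertex `u` off the rays to `q`, and of the
two edges joining `u` to the vertices of attachment on `P`. -/
def IsTypeY (G : SimpleGraph V) (P Q : ℕ → V) (J : Set V) : Prop :=
  ∃ (i j : ℕ) (u : V) (w : (offRails G P Q).Walk u (Q j)),
    w.IsPath ∧
    u ∉ range P ∪ range Q ∧
    J ∩ range P = {P i, P (i + 1)} ∧ J ∩ range Q = {Q j} ∧
    J = {x | x ∈ w.support} ∪ {P i, P (i + 1)} ∧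
    P i ∉ w.support ∧ P (i + 1) ∉ w.support ∧
    ∀ x ∈ J, ∀ y ∈ J, (offRails G P Q).Adj x y ↔
      s(x, y) ∈ w.edges ∨ s(x, y) = s(P i, u) ∨ s(x, y) = s(P (i + 1), u)

/-- The tie `J` is of type `λ`: the same as type `Y` with the roles of `P` and `Q` exchanged. -/
def IsTypeLambda (G : SimpleGraph V) (P Q : ℕ → V) (J : Set V) : Prop :=
  ∃ (i j : ℕ) (v : V) (w : (offRails G P Q).Walk v (P i)),
    w.IsPath ∧
    v ∉ range P ∪ range Q ∧
    J ∩ range P = {P i} ∧ J ∩ range Q = {Q j, Q (j + 1)} ∧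
    J = {x | x ∈ w.support} ∪ {Q j, Q (j + 1)} ∧
    Q j ∉ w.support ∧ Q (j + 1) ∉ w.support ∧
    ∀ x ∈ J, ∀ y ∈ J, (offRails G P Q).Adj x y ↔
      s(x, y) ∈ w.edges ∨ s(x, y) = s(Q j, v) ∨ s(x, y) = s(Q (j + 1), v)

/-- The tie `J` is of type `Y-λ`: its vertices of attachment are two consecutive vertices of `P`
and two consecutive vertices of `Q`, and `J` consists of a path off the rays from `u` to `v`
(possibly `u = v`), of the two edges joining `u` to the vertices of attachment on `P`, and of the
two edges joining `v` to the vertices of attachment on `Q`. -/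
def IsTypeYLambda (G : SimpleGraph V) (P Q : ℕ → V) (J : Set V) : Prop :=
  ∃ (i j : ℕ) (u v : V) (w : (offRails G P Q).Walk u v),
    w.IsPath ∧
    (∀ x ∈ w.support, x ∉ range P ∪ range Q) ∧
    J ∩ range P = {P i, P (i + 1)} ∧ J ∩ range Q = {Q j, Q (j + 1)} ∧
    J = {x | x ∈ w.support} ∪ {P i, P (i + 1)} ∪ {Q j, Q (j + 1)} ∧
    ∀ x ∈ J, ∀ y ∈ J, (offRails G P Q).Adj x y ↔
      s(x, y) ∈ w.edges ∨ s(x, y) = s(P i, u) ∨ s(x, y) = s(P (i + 1), u) ∨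
        s(x, y) = s(Q j, v) ∨ s(x, y) = s(Q (j + 1), v)

/-- All vertices of `J₁` on the ray `r` strictly precede all vertices of `J₂` on `r`. -/
def Precedes (r : ℕ → V) (J₁ J₂ : Set V) : Prop :=
  ∀ i k, r i ∈ J₁ → r k ∈ J₂ → i < k

/-- The ties `J₁` and `J₂` cross: they are attached to `P` and to `Q` in opposite orders. -/
def Cross (P Q : ℕ → V) (J₁ J₂ : Set V) : Prop :=
  (Precedes P J₁ J₂ ∧ Precedes Q J₂ J₁) ∨ (Precedes P J₂ J₁ ∧ Precedes Q J₁ J₂)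

/-- `L` consists of two disjoint induced rays `P`, `Q` and of infinitely many pairwise non-crossing
ties of `P ∪ Q`, each having the property `τ`, one of which joins the initial vertices of the
rays. -/
def IsTieLadder (L : SimpleGraph V) (P Q : ℕ → V) (τ : Set V → Prop) : Prop :=
  IsInducedRay L P ∧ IsInducedRay L Q ∧
  Disjoint (range P) (range Q) ∧
  (∀ x, x ∉ range P ∪ range Q → ∃ J, IsTie L P Q J ∧ x ∈ J) ∧
  (∀ x y, (offRails L P Q).Adj x y → ∃ J, IsTie L P Q J ∧ x ∈ J ∧ y ∈ J) ∧
  (∀ J, IsTie L P Q J → τ J) ∧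
  {J | IsTie L P Q J}.Infinite ∧
  (∀ J₁ J₂, IsTie L P Q J₁ → IsTie L P Q J₂ → J₁ ≠ J₂ → ¬ Cross P Q J₁ J₂) ∧
  ∃ J, IsTie L P Q J ∧ P 0 ∈ J ∧ Q 0 ∈ J

/-- `L` is a member of `𝓛_∞`. -/
def MemL (L : SimpleGraph V) : Prop :=
  ∃ P Q : ℕ → V, IsTieLadder L P Q (IsTypeI L P Q)

/-- `L` is a member of `𝓛^Δ_∞`. -/
def MemLDelta (L : SimpleGraph V) : Prop :=
  ∃ P Q : ℕ → V,
    IsTieLadder L P Q (IsTypeY L P Q) ∨ IsTieLadder L P Q (IsTypeLambda L P Q)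

/-- `L` is a member of `𝓛^{∇Δ}_∞`. -/
def MemLNablaDelta (L : SimpleGraph V) : Prop :=
  ∃ P Q : ℕ → V, IsTieLadder L P Q (IsTypeYLambda L P Q)

end LadderLemma

namespace LadderLemma

variable {V : Type*}


/-! The graph contains two disjoint induced rays that no finite set separates, and any such pair can
be cleaned up to a ladder.

For the rays it suffices to have two disjoint connected vertex sets joined by infinitely many edges
(`exists_infinite_bond`): in each of them a geodesic ray given by König's argument, directed towards
infinitely many ends of these edges, is induced, and the two rays are linked arbitrarily far out
(`exists_linked_rays`). To find the sets, take a geodesic ray R. If some component of G - R has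
infinitely many neighbours on R, use R and that component. Otherwise 2-connectedness makes the
components overlap along R like the links of a chain. A greedy chain of components, dealt out
alternately to two sides together with segments of R, gives the two sets.

Given the rays P and Q, infinitely many P-Q edges yield a messy ladder. Otherwise a trimmed P has no
edge to Q, and shortest connections chosen farther and farther out are independent induced paths
(`exists_link_sequence`). The end x of such a path may have many neighbours on P. If infinitely
often these are one vertex or two consecutive ones, a subsequence is uniform. If not, P is rerouted
through the vertices x, and each x is dropped from its path, which leaves a single attachment.
Should the path be just x infinitely often, the new ray has infinitely many edges to Q, and a messy
ladder appears (`exists_uniform_left`). The same is done at Q, and a sequence uniform at both ends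
is a ladder (`exists_ladder_of_links`). -/

/-- No finite vertex set separates the two rays. -/
def Linked (G : SimpleGraph V) (P Q : ℕ → V) : Prop :=
  ∀ F : Set V, F.Finite → ∃ i j, ∃ w : G.Walk (P i) (Q j), ∀ v ∈ w.support, v ∉ F

/-! ### Local finiteness and connectedness -/

lemma IsLocallyFinite.induce {G : SimpleGraph V} (hG : IsLocallyFinite G) (A : Set V) :
    IsLocallyFinite (G.induce A) := by
  intro v
  refine Finite.of_finite_image (f := Subtype.val) ((hG v).subset ?_)
    Subtype.val_injective.injOn
  rintro _ ⟨x, hx, rfl⟩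
  simpa using hx

lemma IsLocallyFinite.finite_index {G : SimpleGraph V} (hG : IsLocallyFinite G) {P : ℕ → V}
    (hP : Function.Injective P) (v : V) : {k | G.Adj v (P k)}.Finite :=
  (hG v).preimage (f := P) hP.injOn

lemma IsTwoConnected.connected [Infinite V] {G : SimpleGraph V} (h : IsTwoConnected G) :
    G.Connected := by
  classical
  refine { preconnected := fun x y => ?_, nonempty := inferInstance }
  obtain ⟨v, hv⟩ := Infinite.exists_notMem_finset ({x, y} : Finset V)
  simp only [Finset.mem_insert, Finset.mem_singleton, not_or] at hv
  have := (h v).preconnected ⟨x, fun e => hv.1 e.symm⟩ ⟨y, fun e => hv.2 e.symm⟩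
  exact this.map (SimpleGraph.Embedding.induce _).toHom

/-! ### Geodesic rays towards an infinite set, and linked rays -/

/-- The vertices of `U` reached from `a` by a geodesic through `p`. -/
def beyond (H : SimpleGraph V) (a : V) (U : Set V) (p : V) : Set V :=
  {u ∈ U | H.dist a u = H.dist a p + H.dist p u}

/-- Pigeonhole step of König's argument: every target beyond `p` other than `p` itself is also
beyond the second vertex of a geodesic from `p`, and `p` has finitely many neighbours. -/
lemma exists_infinite_beyond_next {H : SimpleGraph V} (hc : H.Connected) (hf : IsLocallyFinite H)
    {a : V} {U : Set V} {p : V} (hp : (beyond H a U p).Infinite) :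
    ∃ q, H.Adj p q ∧ H.dist a q = H.dist a p + 1 ∧ (beyond H a U q).Infinite := by
  by_contra! hcon
  have hfin : (⋃ q ∈ {q ∈ H.neighborSet p | H.dist a q = H.dist a p + 1},
      beyond H a U q).Finite := by
    refine ((hf p).subset (sep_subset _ _)).biUnion ?_
    rintro q ⟨h1, h2⟩
    exact hcon q h1 h2
  refine hp ((hfin.union (finite_singleton p)).subset ?_)
  rintro u ⟨hu, hd⟩
  obtain ⟨w, hw⟩ := hc.exists_walk_length_eq_dist p u
  cases w with
  | nil => right; rfl
  | @cons _ q _ h w' =>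
    left
    have e1 : H.dist q u ≤ w'.length := SimpleGraph.dist_le w'
    have e2 := hc.dist_triangle (u := a) (v := p) (w := q)
    have e3 := hc.dist_triangle (u := a) (v := q) (w := u)
    have e4 : H.dist p q = 1 := SimpleGraph.dist_eq_one_iff_adj.mpr h
    simp only [SimpleGraph.Walk.length_cons] at hw
    simp only [mem_iUnion]
    exact ⟨q, ⟨h, by omega⟩, hu, by omega⟩

lemma exists_geodesic_ray {H : SimpleGraph V} (hc : H.Connected) (hf : IsLocallyFinite H)
    (a : V) {U : Set V} (hU : U.Infinite) :
    ∃ p : ℕ → V, (∀ k, H.Adj (p k) (p (k + 1))) ∧ (∀ k, H.dist a (p k) = k) ∧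
      ∀ k, (beyond H a U (p k)).Infinite := by
  have h0 : (beyond H a U a).Infinite := by
    convert hU using 1
    ext u; simp [beyond]
  choose! nx h1 h2 h3 using fun (q : V) (hq : (beyond H a U q).Infinite) =>
    exists_infinite_beyond_next hc hf hq
  let p : ℕ → V := fun n => nx^[n] a
  have hs : ∀ n, p (n + 1) = nx (p n) := fun n => Function.iterate_succ_apply' nx n a
  have hI : ∀ n, (beyond H a U (p n)).Infinite := by
    intro n
    induction n with
    | zero => exact h0
    | succ n ih => rw [hs]; exact h3 _ ih
  refine ⟨p, fun k => hs k ▸ h1 _ (hI k), fun k => ?_, hI⟩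
  induction k with
  | zero => simp [p]
  | succ n ih => rw [hs, h2 _ (hI n), ih]

/-- Distances from `a` tell the vertices apart, and they differ by at most one along any edge, so a
chord is impossible. -/
lemma isInducedRay_of_dist {H : SimpleGraph V} {a : V} {p : ℕ → V}
    (h1 : ∀ k, H.Adj (p k) (p (k + 1))) (h2 : ∀ k, H.dist a (p k) = k) : IsInducedRay H p := by
  refine ⟨⟨fun i j h => ?_, h1⟩, fun i j h => ?_⟩
  · rw [← h2 i, ← h2 j, h]
  · have := h.diff_dist_adj (u := a)
    have hne : i ≠ j := by rintro rfl; exact h.ne rfl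
    rw [h2, h2] at this
    omega

lemma IsInducedRay.coe {G : SimpleGraph V} {A : Set V} {p : ℕ → A}
    (h : IsInducedRay (G.induce A) p) : IsInducedRay G (fun i => (p i : V)) :=
  ⟨⟨Subtype.val_injective.comp h.1.1, fun i => h.1.2 i⟩, fun i j hij => h.2 i j hij⟩

/-- A geodesic from `p` to `u` prolongs one from `a` to `p`, so it never comes back towards `a`.
This is how walks are kept away from a finite set. -/
lemma exists_walk_of_beyond {H : SimpleGraph V} (hc : H.Connected) {a p u : V} {U : Set V}
    (hu : u ∈ beyond H a U p) :
    ∃ w : H.Walk p u, ∀ x ∈ w.support, H.dist a p ≤ H.dist a x := by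
  classical
  obtain ⟨w, hw⟩ := hc.exists_walk_length_eq_dist p u
  refine ⟨w, fun x hx => ?_⟩
  have e1 := SimpleGraph.dist_le (w.dropUntil x hx)
  have e2 := SimpleGraph.dist_le (w.takeUntil x hx)
  have e3 := congrArg SimpleGraph.Walk.length (w.take_spec hx)
  rw [SimpleGraph.Walk.length_append] at e3
  have e4 := hc.dist_triangle (u := a) (v := x) (w := u)
  have := hu.2
  omega

lemma exists_walk_coe {G : SimpleGraph V} {A : Set V} {x y : A} (w : (G.induce A).Walk x y) :
    ∃ w' : G.Walk (x : V) y, w'.support = w.support.map Subtype.val :=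
  ⟨w.map (SimpleGraph.Embedding.induce A).toHom, SimpleGraph.Walk.support_map _ _⟩

lemma exists_dist_bound {G : SimpleGraph V} {A : Set V} (a : A) {F : Set V} (hF : F.Finite) :
    ∃ N, ∀ x : A, (x : V) ∈ F → (G.induce A).dist a x < N := by
  have : ((G.induce A).dist a '' (Subtype.val ⁻¹' F)).Finite :=
    (hF.preimage Subtype.val_injective.injOn).image _
  obtain ⟨N, hN⟩ := this.bddAbove
  exact ⟨N + 1, fun x hx => Nat.lt_succ_of_le (hN ⟨x, hx, rfl⟩)⟩

/-- Two disjoint connected vertex sets joined by infinitely many edges contain disjoint induced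
rays that are not separated by a finite set. -/
theorem exists_linked_rays {G : SimpleGraph V} (hG : IsLocallyFinite G) {A B : Set V}
    (hA : (G.induce A).Connected) (hB : (G.induce B).Connected) (hAB : Disjoint A B)
    (hinf : {x ∈ A | ∃ y ∈ B, G.Adj x y}.Infinite) :
    ∃ P Q : ℕ → V, IsInducedRay G P ∧ IsInducedRay G Q ∧ Disjoint (range P) (range Q) ∧
      Linked G P Q := by
  obtain ⟨a⟩ := hA.nonempty
  obtain ⟨b⟩ := hB.nonempty
  let U : Set A := {x | ∃ y ∈ B, G.Adj x y}
  have hU : U.Infinite := by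
    intro h
    refine hinf ((h.image Subtype.val).subset ?_)
    rintro x ⟨hx, hy⟩
    exact ⟨⟨x, hx⟩, hy, rfl⟩
  obtain ⟨p, hp1, hp2, hp3⟩ := exists_geodesic_ray hA (hG.induce A) a hU
  choose u hu using fun k => (hp3 k).nonempty
  choose y hyB hy using fun k => (hu k).1
  have hud : ∀ k, k ≤ (G.induce A).dist a (u k) := by
    intro k
    have := (hu k).2
    rw [hp2] at this
    omega
  let z : ℕ → B := fun k => ⟨y k, hyB k⟩
  -- The neighbours of `v` in `A` lie at bounded distance from `a`, while `u k` has distance at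
  -- least `k`; so `z` takes each value finitely often and has infinite range.
  have hfib : ∀ v : B, (z ⁻¹' {v}).Finite := by
    intro v
    obtain ⟨N, hN⟩ := exists_dist_bound (G := G) a (hG v)
    refine (finite_lt_nat N).subset fun k hk => ?_
    have : z k = v := hk
    have h2 : G.Adj (v : V) (u k) := by rw [← this]; exact (hy k).symm
    exact (hud k).trans_lt (hN _ h2)
  have hZ : (range z).Infinite := by
    intro h
    have : (⋃ v ∈ range z, z ⁻¹' {v}).Finite := h.biUnion fun v _ => hfib v
    refine infinite_univ (this.subset fun k _ => ?_)
    simp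
  obtain ⟨q, hq1, hq2, hq3⟩ := exists_geodesic_ray hB (hG.induce B) b hZ
  refine ⟨_, _, (isInducedRay_of_dist hp1 hp2).coe, (isInducedRay_of_dist hq1 hq2).coe, ?_, ?_⟩
  · rw [disjoint_left]
    rintro _ ⟨i, rfl⟩ ⟨j, h⟩
    exact disjoint_left.mp hAB (p i).2 (by simp [← h])
  · intro F hF
    obtain ⟨N, hN⟩ := exists_dist_bound (G := G) a hF
    obtain ⟨M, hM⟩ := exists_dist_bound (G := G) b hF
    -- Only finitely many values `z k` have `k < N`, but infinitely many lie beyond `q M`.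
    obtain ⟨k, hk, hkN⟩ : ∃ k, z k ∈ beyond (G.induce B) b (range z) (q M) ∧ N ≤ k := by
      by_contra! hcon
      refine hq3 M (((finite_lt_nat N).image z).subset ?_)
      rintro v hv
      obtain ⟨k, rfl⟩ := hv.1
      exact ⟨k, hcon k hv, rfl⟩
    obtain ⟨w1, hw1⟩ := exists_walk_of_beyond hA (hu k)
    obtain ⟨w2, hw2⟩ := exists_walk_of_beyond hB hk
    obtain ⟨w1', hw1'⟩ := exists_walk_coe w1
    obtain ⟨w2', hw2'⟩ := exists_walk_coe w2.reverse
    -- From `p k` outwards to `u k`, across to `z k`, and back to `q M`: the walk stays at distance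
    -- at least `N` from `a` in `A`, and at least `M` from `b` in `B`.
    refine ⟨k, M, w1'.append (.cons (hy k) w2'), ?_⟩
    intro v hv hvF
    rw [SimpleGraph.Walk.mem_support_append_iff, SimpleGraph.Walk.support_cons, List.mem_cons,
      hw1', hw2', List.mem_map, List.mem_map] at hv
    have key1 : ∀ x ∈ w1.support, (x : V) ∉ F := by
      intro x hx hxF
      have e1 := hN x hxF
      have e2 := hw1 x hx
      rw [hp2] at e2
      omega
    have key2 : ∀ x ∈ w2.support, (x : V) ∉ F := by
      intro x hx hxF
      have e1 := hM x hxF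
      have e2 := hw2 x hx
      rw [hq2] at e2
      omega
    rcases hv with ⟨x, hx, rfl⟩ | rfl | ⟨x, hx, rfl⟩
    · exact key1 x hx hvF
    · exact key1 _ w1.end_mem_support hvF
    · rw [SimpleGraph.Walk.support_reverse, List.mem_reverse] at hx
      exact key2 x hx hvF


/-! ### Walks inside a vertex set -/

/-- `u` and `v` are joined by a walk inside `s`. -/
def JoinedIn (G : SimpleGraph V) (s : Set V) (u v : V) : Prop :=
  ∃ w : G.Walk u v, ∀ x ∈ w.support, x ∈ s

namespace JoinedIn

variable {G : SimpleGraph V} {s t : Set V} {u v w : V}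

lemma refl (h : u ∈ s) : JoinedIn G s u u := ⟨.nil, by simpa using h⟩

lemma symm (h : JoinedIn G s u v) : JoinedIn G s v u := by
  obtain ⟨p, hp⟩ := h
  exact ⟨p.reverse, by simpa using hp⟩

lemma trans (h : JoinedIn G s u v) (h' : JoinedIn G s v w) : JoinedIn G s u w := by
  obtain ⟨p, hp⟩ := h
  obtain ⟨q, hq⟩ := h'
  refine ⟨p.append q, fun x hx => ?_⟩
  rcases SimpleGraph.Walk.mem_support_append_iff .. |>.mp hx with h | h
  exacts [hp x h, hq x h]

lemma mono (h : JoinedIn G s u v) (hst : s ⊆ t) : JoinedIn G t u v := by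
  obtain ⟨p, hp⟩ := h
  exact ⟨p, fun x hx => hst (hp x hx)⟩

lemma of_adj (h : G.Adj u v) (hu : u ∈ s) (hv : v ∈ s) : JoinedIn G s u v :=
  ⟨.cons h .nil, by simp [hu, hv]⟩

lemma connected (hu : u ∈ s) (h : ∀ v ∈ s, JoinedIn G s u v) : (G.induce s).Connected := by
  have key : ∀ v : s, (G.induce s).Reachable ⟨u, hu⟩ v := by
    rintro ⟨v, hv⟩
    obtain ⟨p, hp⟩ := h v hv
    exact ⟨p.induce s hp⟩
  exact { preconnected := fun x y => (key x).symm.trans (key y), nonempty := ⟨⟨u, hu⟩⟩ }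

lemma of_reachable {x y : s} (h : (G.induce s).Reachable x y) : JoinedIn G s x y := by
  obtain ⟨p⟩ := h
  obtain ⟨q, hq⟩ := exists_walk_coe p
  refine ⟨q, fun v hv => ?_⟩
  rw [hq, List.mem_map] at hv
  obtain ⟨z, -, rfl⟩ := hv
  exact z.2

lemma segment {R : ℕ → V} (hR : ∀ i, G.Adj (R i) (R (i + 1))) {i j : ℕ} (hij : i ≤ j)
    (hs : ∀ k, i ≤ k → k ≤ j → R k ∈ s) : JoinedIn G s (R i) (R j) := by
  induction j, hij using Nat.le_induction with
  | base => exact refl (hs i le_rfl le_rfl)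
  | succ j hij ih =>
    exact (ih fun k h1 h2 => hs k h1 (by omega)).trans
      (of_adj (hR j) (hs j hij (by omega)) (hs _ (by omega) le_rfl))

end JoinedIn

/-! ### Components of the complement of a ray, and the infinite bond -/

/-- The vertices of a component of `G - R`. -/
def body {G : SimpleGraph V} {R : ℕ → V} (c : (G.induce (range R)ᶜ).ConnectedComponent) : Set V :=
  Subtype.val '' c.supp

/-- The positions on `R` of the neighbours of a component of `G - R`. -/
def feet {G : SimpleGraph V} {R : ℕ → V} (c : (G.induce (range R)ᶜ).ConnectedComponent) : Set ℕ :=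
  {i | ∃ x ∈ body c, G.Adj x (R i)}

section Components

variable {G : SimpleGraph V} {R : ℕ → V}

lemma notMem_range_of_mem_body {c : (G.induce (range R)ᶜ).ConnectedComponent} {x : V}
    (hx : x ∈ body c) : x ∉ range R := by
  obtain ⟨y, -, rfl⟩ := hx
  exact y.2

lemma exists_mem_body {x : V} (hx : x ∉ range R) :
    ∃ c : (G.induce (range R)ᶜ).ConnectedComponent, x ∈ body c :=
  ⟨(G.induce (range R)ᶜ).connectedComponentMk ⟨x, hx⟩, ⟨x, hx⟩, rfl, rfl⟩

lemma eq_of_mem_body {c d : (G.induce (range R)ᶜ).ConnectedComponent} {x : V}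
    (hc : x ∈ body c) (hd : x ∈ body d) : c = d := by
  obtain ⟨y, hy, rfl⟩ := hc
  obtain ⟨z, hz, hzy⟩ := hd
  obtain rfl := Subtype.val_injective hzy
  exact hy.symm.trans hz

lemma eq_of_adj_body {c d : (G.induce (range R)ᶜ).ConnectedComponent} {x y : V}
    (hc : x ∈ body c) (hd : y ∈ body d) (h : G.Adj x y) : c = d := by
  obtain ⟨x, hx, rfl⟩ := hc
  obtain ⟨y, hy, rfl⟩ := hd
  rw [SimpleGraph.ConnectedComponent.mem_supp_iff] at hx hy
  rw [← hx, ← hy]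
  exact SimpleGraph.ConnectedComponent.sound (SimpleGraph.Adj.reachable h)

lemma joinedIn_body {c : (G.induce (range R)ᶜ).ConnectedComponent} {x y : V}
    (hx : x ∈ body c) (hy : y ∈ body c) : JoinedIn G (body c) x y := by
  obtain ⟨x, hx, rfl⟩ := hx
  obtain ⟨y, hy, rfl⟩ := hy
  obtain ⟨w⟩ := SimpleGraph.ConnectedComponent.exact (hx.trans hy.symm)
  obtain ⟨q, hq⟩ := exists_walk_coe w
  refine ⟨q, fun v hv => ?_⟩
  rw [hq, List.mem_map] at hv
  obtain ⟨z, hz, rfl⟩ := hv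
  classical
  refine ⟨z, ?_, rfl⟩
  rw [SimpleGraph.ConnectedComponent.mem_supp_iff] at hx ⊢
  rw [← hx]
  exact SimpleGraph.ConnectedComponent.sound ⟨(w.takeUntil z hz).reverse⟩

/-- In a 2-connected graph every inner vertex of an induced ray `R` is bridged by a component
of `G - R`. -/
lemma exists_bridging_component (h2 : IsTwoConnected G) (hR : IsInducedRay G R) {i : ℕ}
    (hi : 1 ≤ i) :
    ∃ c : (G.induce (range R)ᶜ).ConnectedComponent,
      (∃ a ∈ feet c, a < i) ∧ ∃ b ∈ feet c, i < b := by
  by_contra! hcon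
  -- `T` is everything attached to `R` before `i`. Without a bridging component, `T` can be left
  -- only through `R i`, so `R i` would separate `R 0` from `R (i + 1)`.
  let T : Set V := {v | (∃ j < i, R j = v) ∨
    ∃ c : (G.induce (range R)ᶜ).ConnectedComponent, v ∈ body c ∧ ∃ a ∈ feet c, a < i}
  have hT : ∀ u v, G.Adj u v → v ≠ R i → u ∈ T → v ∈ T := by
    intro u v huv hv hu
    by_cases hvR : v ∈ range R
    · obtain ⟨k, rfl⟩ := hvR
      refine Or.inl ⟨k, ?_, rfl⟩
      have hki : k ≠ i := fun h => hv (by rw [h])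
      rcases hu with ⟨j, hj, rfl⟩ | ⟨c, hc, ha⟩
      · have := hR.2 _ _ huv
        omega
      · have := hcon c ha k ⟨u, hc, huv⟩
        omega
    · obtain ⟨d, hd⟩ := exists_mem_body (G := G) hvR
      rcases hu with ⟨j, hj, rfl⟩ | ⟨c, hc, ha⟩
      · exact Or.inr ⟨d, hd, j, ⟨v, hd, huv.symm⟩, hj⟩
      · obtain rfl := eq_of_adj_body hc hd huv
        exact Or.inr ⟨c, hd, ha⟩
  have hne : ∀ j, j ≠ i → R j ∈ ({R i}ᶜ : Set V) := fun j hj h => hj (hR.1.1 h)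
  obtain ⟨w, hw⟩ := JoinedIn.of_reachable ((h2 (R i)).preconnected ⟨R 0, hne 0 (by omega)⟩
    ⟨R (i + 1), hne _ (by omega)⟩)
  have key : ∀ u v : V, ∀ w : G.Walk u v, (∀ x ∈ w.support, x ∈ ({R i}ᶜ : Set V)) →
      u ∈ T → v ∈ T := by
    intro u v w
    induction w with
    | nil => exact fun _ h => h
    | cons h p ih =>
      intro hw hu
      simp only [SimpleGraph.Walk.support_cons, List.mem_cons, forall_eq_or_imp] at hw
      exact ih hw.2 (hT _ _ h (hw.2 _ p.start_mem_support) hu)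
  rcases key _ _ w hw (Or.inl ⟨0, by omega, rfl⟩) with ⟨j, hj, h⟩ | ⟨c, hc, -⟩
  · have := hR.1.1 h
    omega
  · exact notMem_range_of_mem_body hc ⟨_, rfl⟩

lemma finite_low_components (hG : IsLocallyFinite G) (i : ℕ) :
    {c : (G.induce (range R)ᶜ).ConnectedComponent | ∃ a ∈ feet c, a < i}.Finite := by
  have h1 : (⋃ a ∈ {a | a < i}, G.neighborSet (R a)).Finite :=
    (finite_lt_nat i).biUnion fun a _ => hG _
  have h2 := (h1.preimage (f := (Subtype.val : ((range R)ᶜ : Set V) → V))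
    Subtype.val_injective.injOn).image (G.induce (range R)ᶜ).connectedComponentMk
  refine h2.subset ?_
  rintro c ⟨a, ⟨_, ⟨x, hx, rfl⟩, hxa⟩, ha⟩
  refine ⟨x, ?_, hx⟩
  simp only [mem_preimage, mem_iUnion]
  exact ⟨a, ha, hxa.symm⟩

/-- Finitely many components have a foot below `i`, each with finitely many feet, so a highest foot
exists; a bridging component places it above `i`. This is the greedy step of the chain. -/
lemma exists_farthest_component (hG : IsLocallyFinite G) (h2 : IsTwoConnected G)
    (hR : IsInducedRay G R)
    (hfin : ∀ c : (G.induce (range R)ᶜ).ConnectedComponent, (feet c).Finite) {i : ℕ}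
    (hi : 1 ≤ i) :
    ∃ (c : (G.induce (range R)ᶜ).ConnectedComponent) (b : ℕ), (∃ a ∈ feet c, a < i) ∧
      b ∈ feet c ∧ i < b ∧
      ∀ c' : (G.induce (range R)ᶜ).ConnectedComponent, (∃ a ∈ feet c', a < i) →
        ∀ b' ∈ feet c', b' ≤ b := by
  let C := {c : (G.induce (range R)ᶜ).ConnectedComponent | ∃ a ∈ feet c, a < i}
  have hfinU : (⋃ c ∈ C, feet c).Finite := (finite_low_components hG i).biUnion fun c _ => hfin c
  obtain ⟨c₀, hc₀, b₀, hb₀, hib₀⟩ := exists_bridging_component h2 hR hi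
  have hmem : b₀ ∈ ⋃ c ∈ C, feet c := by
    simp only [mem_iUnion]; exact ⟨c₀, hc₀, hb₀⟩
  obtain ⟨b, hb, hmax⟩ := hfinU.exists_maximal ⟨b₀, hmem⟩
  simp only [mem_iUnion] at hb
  obtain ⟨c, hc, hbc⟩ := hb
  have hle : ∀ b' ∈ ⋃ c ∈ C, feet c, b' ≤ b := fun b' h' => by
    rcases le_total b' b with h | h
    exacts [h, hmax h' h]
  refine ⟨c, b, hc, hbc, hib₀.trans_le (hle _ hmem), fun c' hc' b' hb' => hle _ ?_⟩
  simp only [mem_iUnion]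
  exact ⟨c', hc', hb'⟩

end Components

/-- An infinite locally finite 2-connected graph has two disjoint connected vertex sets joined by
infinitely many edges. -/
theorem exists_infinite_bond [Infinite V] {G : SimpleGraph V} (hG : IsLocallyFinite G)
    (h2 : IsTwoConnected G) :
    ∃ A B : Set V, (G.induce A).Connected ∧ (G.induce B).Connected ∧ Disjoint A B ∧
      {x ∈ A | ∃ y ∈ B, G.Adj x y}.Infinite := by
  obtain ⟨a⟩ := (inferInstance : Nonempty V)
  obtain ⟨R, hR1, hR2, -⟩ := exists_geodesic_ray h2.connected hG a infinite_univ
  have hR : IsInducedRay G R := isInducedRay_of_dist hR1 hR2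
  by_cases hfin : ∀ c : (G.induce (range R)ᶜ).ConnectedComponent, (feet c).Finite
  swap
  · push Not at hfin
    obtain ⟨c, hc⟩ := hfin
    obtain ⟨i, x, hx, hxi⟩ := Set.Infinite.nonempty hc
    refine ⟨range R, body c, JoinedIn.connected ⟨0, rfl⟩ ?_,
      JoinedIn.connected hx fun v hv => joinedIn_body hx hv, ?_, ?_⟩
    · rintro _ ⟨j, rfl⟩
      exact JoinedIn.segment hR1 (Nat.zero_le j) fun k _ _ => ⟨k, rfl⟩
    · rw [disjoint_right]
      exact fun v hv => notMem_range_of_mem_body hv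
    · refine (Infinite.image hR.1.1.injOn hc).mono ?_
      rintro _ ⟨j, ⟨y, hy, hyj⟩, rfl⟩
      exact ⟨⟨j, rfl⟩, y, hy, hyj.symm⟩
  choose! c nx h1 h3 h4 h5 using fun (i : ℕ) (hi : 1 ≤ i) =>
    exists_farthest_component hG h2 hR hfin hi
  -- Greedy chain: `b (n + 1)` is the highest foot of any component with a foot below `b n`. It
  -- starts at 1 because only inner vertices of `R` are bridged.
  let b : ℕ → ℕ := fun n => nx^[n] 1
  have hb : ∀ n, b (n + 1) = nx (b n) := fun n => Function.iterate_succ_apply' nx n 1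
  have hb1 : ∀ n, 1 ≤ b n := by
    intro n
    induction n with
    | zero => exact le_rfl
    | succ n ih => rw [hb]; have := h4 _ ih; omega
  have hbm : StrictMono b := strictMono_nat_of_lt_succ fun n => by rw [hb]; exact h4 _ (hb1 n)
  let e : ℕ → (G.induce (range R)ᶜ).ConnectedComponent :=
    fun n => c (b n) (hb1 n)
  have htop : ∀ n, b (n + 1) ∈ feet (e n) := fun n => by rw [hb]; exact h3 _ (hb1 n)
  have hlow : ∀ n, ∃ a ∈ feet (e (n + 1)), b n ≤ a ∧ a < b (n + 1) := by
    intro n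
    obtain ⟨a, ha, hab⟩ := h1 _ (hb1 (n + 1))
    refine ⟨a, ha, ?_, hab⟩
    -- A foot below `b n` would make this component a candidate at stage `n`, so its foot `b (n +
    -- 2)` could not exceed `b (n + 1)`.
    by_contra! hlt
    have := h5 _ (hb1 n) _ ⟨a, ha, hlt⟩ _ (htop (n + 1))
    rw [← hb] at this
    exact absurd this (hbm (by omega)).not_ge
  have hinj : ∀ m n, m < n → e m ≠ e n := by
    intro m n hmn he
    obtain ⟨a, ha, hab⟩ := h1 _ (hb1 m)
    have := h5 _ (hb1 m) (e n) (he ▸ ⟨a, ha, hab⟩) _ (htop n)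
    rw [← hb] at this
    exact absurd this (hbm (by omega)).not_ge
  -- Each component receives the segment of `R` that starts at its highest foot. By `hlow`,
  -- component `n + 2` has a foot in the segment of `X n`, so `X n` and `X (n + 2)` are adjacent,
  -- and the even and the odd sets have connected unions.
  let X : ℕ → Set V := fun n => body (e n) ∪ R '' Ico (b (n + 1)) (b (n + 2))
  have hRX : ∀ n j, b (n + 1) ≤ j → j < b (n + 2) → R j ∈ X n :=
    fun n j hj hj' => Or.inr ⟨j, ⟨hj, hj'⟩, rfl⟩
  have hbX : ∀ n, R (b (n + 1)) ∈ X n := fun n => hRX _ _ le_rfl (hbm (by omega))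
  have hX : ∀ n, ∀ v ∈ X n, JoinedIn G (X n) (R (b (n + 1))) v := by
    rintro n v (hv | ⟨j, hj, rfl⟩)
    · obtain ⟨x, hx, hxb⟩ := htop n
      exact (JoinedIn.of_adj hxb.symm (hbX n) (Or.inl hx)).trans
        ((joinedIn_body hx hv).mono subset_union_left)
    · exact JoinedIn.segment hR1 hj.1 fun k hk hk' => hRX _ _ hk (hk'.trans_lt hj.2)
  have hstep : ∀ n, JoinedIn G (X n ∪ X (n + 2)) (R (b (n + 1))) (R (b (n + 3))) := by
    intro n
    obtain ⟨a, ⟨x, hx, hxa⟩, ha1, ha2⟩ := hlow (n + 1)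
    have hRa := hRX n a ha1 ha2
    exact ((hX n _ hRa).mono subset_union_left).trans
      ((JoinedIn.of_adj hxa.symm (Or.inl hRa) (Or.inr (Or.inl hx))).trans
        ((hX (n + 2) _ (Or.inl hx)).symm.mono subset_union_right))
  have hdisj : ∀ m n, m ≠ n → Disjoint (X m) (X n) := by
    have : ∀ m n, m < n → Disjoint (X m) (X n) := by
      intro m n hmn
      rw [disjoint_left]
      rintro v (hv | ⟨j, hj, rfl⟩) (hv' | ⟨k, hk, hkv⟩)
      · exact hinj m n hmn (eq_of_mem_body hv hv')
      · exact notMem_range_of_mem_body hv ⟨k, hkv⟩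
      · exact notMem_range_of_mem_body hv' ⟨j, rfl⟩
      · have e1 := hR.1.1 hkv
        have e2 := hbm.monotone (show m + 2 ≤ n + 1 by omega)
        have e3 := hj.2
        have e4 := hk.1
        omega
    intro m n hmn
    rcases lt_or_gt_of_ne hmn with h | h
    exacts [this m n h, (this n m h).symm]
  have hconn : ∀ r, (G.induce (⋃ n, X (2 * n + r))).Connected := by
    intro r
    have hsub : ∀ n, X (2 * n + r) ⊆ ⋃ n, X (2 * n + r) := fun n =>
      subset_iUnion (fun n => X (2 * n + r)) n
    have hbase : ∀ n, JoinedIn G (⋃ n, X (2 * n + r)) (R (b (2 * 0 + r + 1)))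
        (R (b (2 * n + r + 1))) := by
      intro n
      induction n with
      | zero => exact JoinedIn.refl (hsub 0 (hbX _))
      | succ n ih =>
        have := hsub (n + 1)
        rw [show 2 * (n + 1) + r = 2 * n + r + 2 by ring] at this ⊢
        exact ih.trans ((hstep (2 * n + r)).mono (union_subset (hsub n) this))
    refine JoinedIn.connected (hsub 0 (hbX _)) fun v hv => ?_
    obtain ⟨n, hn⟩ := mem_iUnion.mp hv
    exact (hbase n).trans ((hX _ _ hn).mono (hsub n))
  refine ⟨⋃ n, X (2 * n + 0), ⋃ n, X (2 * n + 1), hconn 0, hconn 1, ?_, ?_⟩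
  · simp only [disjoint_iUnion_left, disjoint_iUnion_right]
    exact fun m n => hdisj _ _ (by omega)
  -- The joining edges are the edges of `R` between the last vertex of an even segment and the first
  -- vertex of the next, odd one.
  · refine (infinite_range_of_injective (f := fun n => R (b (2 * n + 2) - 1)) ?_).mono ?_
    · intro m n hmn
      have e1 := hR.1.1 hmn
      have e2 := hb1 (2 * m + 2)
      have e3 := hb1 (2 * n + 2)
      have := hbm.injective (show b (2 * m + 2) = b (2 * n + 2) by omega)
      omega
    · rintro _ ⟨n, rfl⟩
      have e1 : b (2 * n + 1) < b (2 * n + 2) := hbm (by omega)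
      refine ⟨mem_iUnion.mpr ⟨n, hRX (2 * n) _ (by omega) (by omega)⟩, R (b (2 * n + 2)),
        mem_iUnion.mpr ⟨n, hbX (2 * n + 1)⟩, ?_⟩
      have := hR1 (b (2 * n + 2) - 1)
      rwa [Nat.sub_add_cancel (by omega)] at this


/-! ### Messy ladders from infinitely many edges between the rays -/

lemma IsInducedRay.restrict {G : SimpleGraph V} {A : Set V} {p : ℕ → A}
    (h : IsInducedRay G (fun i => (p i : V))) : IsInducedRay (G.induce A) p :=
  ⟨⟨fun _ _ hij => h.1.1 (congrArg Subtype.val hij), fun i => h.1.2 i⟩, fun i j hij => h.2 i j hij⟩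

lemma IsInducedRay.tail {G : SimpleGraph V} {p : ℕ → V} (h : IsInducedRay G p) (n : ℕ) :
    IsInducedRay G (fun i => p (n + i)) :=
  ⟨⟨fun i j hij => by have := h.1.1 hij; omega, fun i => h.1.2 (n + i)⟩,
    fun i j hij => by have := h.2 _ _ hij; omega⟩

/-- Disjoint induced rays joined by infinitely many edges give an induced messy ladder. -/
theorem exists_messyLadder {G : SimpleGraph V} (hG : IsLocallyFinite G) {P Q : ℕ → V}
    (hP : IsInducedRay G P) (hQ : IsInducedRay G Q) (hPQ : Disjoint (range P) (range Q))
    (hinf : {i | ∃ j, G.Adj (P i) (Q j)}.Infinite) :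
    ∃ S : Set V, IsMessyLadder (G.induce S) := by
  -- Local finiteness leaves only finitely many `i` below `N` or adjacent to some `Q j` with `j <
  -- N`.
  have far : ∀ N, ∃ i j, N ≤ i ∧ N ≤ j ∧ G.Adj (P i) (Q j) := by
    intro N
    have hfin : ({i | i < N} ∪ ⋃ j ∈ {j | j < N}, {i | G.Adj (Q j) (P i)}).Finite :=
      (finite_lt_nat N).union ((finite_lt_nat N).biUnion fun j _ => hG.finite_index hP.1.1 _)
    obtain ⟨i, ⟨j, hij⟩, hi⟩ := (hinf.sdiff hfin).nonempty
    simp only [mem_union, mem_iUnion, mem_ofPred_eq, not_or, not_exists, not_lt] at hi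
    exact ⟨i, j, hi.1, not_lt.mp fun h => hi.2 j h hij.symm, hij⟩
  -- Both rails are cut to start at the ends of one cross edge, which makes their initial vertices
  -- adjacent.
  obtain ⟨i₀, j₀, -, -, h₀⟩ := far 0
  let S : Set V := range (fun k => P (i₀ + k)) ∪ range (fun k => Q (j₀ + k))
  let W : ℕ → S := fun k => ⟨P (i₀ + k), Or.inl ⟨k, rfl⟩⟩
  let X : ℕ → S := fun k => ⟨Q (j₀ + k), Or.inr ⟨k, rfl⟩⟩
  have hW : IsInducedRay (G.induce S) W := (hP.tail i₀).restrict
  have hX : IsInducedRay (G.induce S) X := (hQ.tail j₀).restrict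
  have hne : ∀ i j, P i ≠ Q j := fun i j h => disjoint_left.mp hPQ ⟨i, rfl⟩ ⟨j, h.symm⟩
  have hWX : ∀ i j, W i ≠ X j := fun i j h => hne _ _ (congrArg Subtype.val h)
  -- Cross edges with both ends increasing are disjoint paths of length one, witnessing the common
  -- end.
  obtain ⟨f, hf, hlt⟩ := exists_seq_of_forall_finset_exists
    (fun p : ℕ × ℕ => (G.induce S).Adj (W p.1) (X p.2))
    (fun p q => p.1 < q.1 ∧ p.2 < q.2) (by
      intro s _
      obtain ⟨i, j, hi, hj, hij⟩ :=
        far (s.sup (fun p => p.1) + s.sup (fun p => p.2) + i₀ + j₀ + 1)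
      refine ⟨(i - i₀, j - j₀), ?_, fun x hx => ?_⟩
      · change G.Adj (P (i₀ + (i - i₀))) (Q (j₀ + (j - j₀)))
        rwa [Nat.add_sub_cancel' (by omega), Nat.add_sub_cancel' (by omega)]
      · have e1 := Finset.le_sup (f := fun p : ℕ × ℕ => p.1) hx
        have e2 := Finset.le_sup (f := fun p : ℕ × ℕ => p.2) hx
        dsimp only at e1 e2 ⊢
        omega)
  have hdis : ∀ m n, m < n →
      (SimpleGraph.Walk.cons (hf m) .nil).support.Disjoint
        (SimpleGraph.Walk.cons (hf n) .nil).support := by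
    intro m n hmn
    obtain ⟨e1, e2⟩ := hlt m n hmn
    have h1 : W (f m).1 ≠ W (f n).1 := fun h => e1.ne (hW.1.1 h)
    have h2 : X (f m).2 ≠ X (f n).2 := fun h => e2.ne (hX.1.1 h)
    simp [List.disjoint_left, h1, h2, hWX, (hWX _ _).symm]
  refine ⟨S, W, X, hG.induce S, hW, hX, ?_, ?_, ?_, h₀⟩
  · rw [disjoint_left]
    rintro _ ⟨i, rfl⟩ ⟨j, h⟩
    exact hWX i j h.symm
  · ext ⟨x, hx⟩
    simp only [mem_union, mem_univ, iff_true]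
    rcases hx with ⟨k, rfl⟩ | ⟨k, rfl⟩
    exacts [Or.inl ⟨k, rfl⟩, Or.inr ⟨k, rfl⟩]
  · refine ⟨fun n => W (f n).1, fun n => X (f n).2, fun n => .cons (hf n) .nil,
      fun n => ⟨?_, ⟨_, rfl⟩, ⟨_, rfl⟩⟩, fun m n hmn => ?_⟩
    · simpa using hWX _ _
    · rcases lt_or_gt_of_ne hmn with h | h
      exacts [hdis m n h, (hdis n m h).symm]


/-! ### Independent links between two rays -/

/-- An induced path off the rays `P` and `Q` in which exactly the first vertex has neighbours
on `P` and exactly the last one has neighbours on `Q`. -/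
structure Link (G : SimpleGraph V) (P Q : ℕ → V) where
  x : V
  y : V
  walk : G.Walk x y
  isPath : walk.IsPath
  chordless : ∀ u ∈ walk.support, ∀ v ∈ walk.support, G.Adj u v → s(u, v) ∈ walk.edges
  off_left : ∀ v ∈ walk.support, v ∉ range P
  off_right : ∀ v ∈ walk.support, v ∉ range Q
  adj_left : ∀ v ∈ walk.support, ∀ k, G.Adj v (P k) → v = x
  adj_right : ∀ v ∈ walk.support, ∀ k, G.Adj v (Q k) → v = y
  exists_left : ∃ k, G.Adj x (P k)
  exists_right : ∃ k, G.Adj y (Q k)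

namespace Link

variable {G : SimpleGraph V} {P Q : ℕ → V}

/-- The vertex set of a link. -/
def verts (l : Link G P Q) : Set V := {v | v ∈ l.walk.support}

lemma x_mem (l : Link G P Q) : l.x ∈ l.verts := l.walk.start_mem_support

lemma y_mem (l : Link G P Q) : l.y ∈ l.verts := l.walk.end_mem_support

/-- The link traversed from `Q` to `P`. -/
def reverse (l : Link G P Q) : Link G Q P where
  x := l.y
  y := l.x
  walk := l.walk.reverse
  isPath := l.isPath.reverse
  chordless := by simpa using l.chordless
  off_left := by simpa using l.off_right
  off_right := by simpa using l.off_left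
  adj_left := by simpa using l.adj_right
  adj_right := by simpa using l.adj_left
  exists_left := l.exists_right
  exists_right := l.exists_left

@[simp] lemma verts_reverse (l : Link G P Q) : l.reverse.verts = l.verts := by
  ext v; simp [verts, reverse]

/-- `l` and `l'` are neither intersecting nor adjacent, and `l` is attached to both rays
before `l'`. -/
def Before (l l' : Link G P Q) : Prop :=
  (∀ u ∈ l.verts, ∀ v ∈ l'.verts, u ≠ v ∧ ¬ G.Adj u v) ∧
  (∀ k k', G.Adj l.x (P k) → G.Adj l'.x (P k') → k < k') ∧
  ∀ k k', G.Adj l.y (Q k) → G.Adj l'.y (Q k') → k < k'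

lemma Before.reverse {l l' : Link G P Q} (h : l.Before l') : l.reverse.Before l'.reverse := by
  refine ⟨?_, h.2.2, h.2.1⟩
  simpa using h.1

end Link

section

variable {G : SimpleGraph V} {P Q : ℕ → V}

/-- A walk from a neighbour of `P` to a neighbour of `Q` that avoids both rays and `F`. -/
def Connects (P Q : ℕ → V) (F : Set V) {x y : V} (w : G.Walk x y) : Prop :=
  (∀ v ∈ w.support, v ∉ F ∧ v ∉ range P ∧ v ∉ range Q) ∧
  (∃ k, G.Adj x (P k)) ∧ ∃ k, G.Adj y (Q k)

/-- Induction along the walk, remembering in `hu` the stretch since its last visit to `P`. The first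
step from such a stretch onto `Q` completes the connection; a direct step from `P` to `Q` is
excluded by `hno`. -/
lemma exists_connects (hPQ : Disjoint (range P) (range Q)) (hno : ∀ i j, ¬ G.Adj (P i) (Q j))
    {F : Set V} {u v : V} (w : G.Walk u v) (hw : ∀ z ∈ w.support, z ∉ F) (hv : v ∈ range Q)
    (hu : u ∈ range P ∨ ∃ (x : V) (p : G.Walk x u),
      (∀ z ∈ p.support, z ∉ F ∧ z ∉ range P ∧ z ∉ range Q) ∧ ∃ k, G.Adj x (P k)) :
    ∃ (x y : V) (p : G.Walk x y), Connects P Q F p := by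
  induction w with
  | nil =>
    rcases hu with hu | ⟨x, p, hp, -⟩
    · exact (disjoint_left.mp hPQ hu hv).elim
    · exact ((hp _ p.end_mem_support).2.2 hv).elim
  | @cons u u' v h q ih =>
    simp only [SimpleGraph.Walk.support_cons, List.mem_cons, forall_eq_or_imp] at hw
    by_cases hP : u' ∈ range P
    · exact ih hw.2 hv (Or.inl hP)
    by_cases hQ : u' ∈ range Q
    · obtain ⟨j, rfl⟩ := hQ
      rcases hu with ⟨i, rfl⟩ | ⟨x, p, hp, hx⟩
      · exact (hno i j h).elim
      · exact ⟨x, u, p, hp, hx, j, h⟩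
    · have hu' : u' ∉ F ∧ u' ∉ range P ∧ u' ∉ range Q := ⟨hw.2 _ q.start_mem_support, hP, hQ⟩
      refine ih hw.2 hv (Or.inr ?_)
      rcases hu with ⟨i, rfl⟩ | ⟨x, p, hp, hx⟩
      · exact ⟨u', .nil, by simpa using hu', i, h.symm⟩
      · refine ⟨x, p.concat h, fun z hz => ?_, hx⟩
        rw [SimpleGraph.Walk.support_concat, List.mem_append, List.mem_singleton] at hz
        rcases hz with hz | rfl
        exacts [hp z hz, hu']

/-- A shortest connection avoiding `F` is a link: a chord, or an inner neighbour of either ray,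
would give a shorter connection. -/
lemma exists_link (hPQ : Disjoint (range P) (range Q)) (hno : ∀ i j, ¬ G.Adj (P i) (Q j))
    (hl : Linked G P Q) {F : Set V} (hF : F.Finite) :
    ∃ l : Link G P Q, ∀ v ∈ l.verts, v ∉ F := by
  classical
  obtain ⟨i, j, w₀, hw₀⟩ := hl F hF
  have hex : ∃ n, ∃ (x y : V) (p : G.Walk x y), Connects P Q F p ∧ p.length = n := by
    obtain ⟨x, y, p, hp⟩ := exists_connects hPQ hno w₀ hw₀ ⟨j, rfl⟩ (Or.inl ⟨i, rfl⟩)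
    exact ⟨_, x, y, p, hp, rfl⟩
  have hmin : ∀ (x y : V) (p : G.Walk x y), Connects P Q F p → Nat.find hex ≤ p.length :=
    fun x y p hp => Nat.find_min' hex ⟨x, y, p, hp, rfl⟩
  obtain ⟨x, y, p₀, hp₀, hlen⟩ := Nat.find_spec hex
  have hp : Connects P Q F p₀.bypass :=
    ⟨fun v hv => hp₀.1 v (p₀.support_bypass_subset_support hv), hp₀.2⟩
  have hlen' : p₀.bypass.length ≤ Nat.find hex := hlen ▸ p₀.length_bypass_le_length
  have hpath := p₀.bypass_isPath
  generalize p₀.bypass = p at hp hlen' hpath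
  have htake : ∀ n, ∀ v ∈ (p.take n).support, v ∈ p.support := fun n v hv => by
    rw [SimpleGraph.Walk.support_take] at hv
    exact List.mem_of_mem_take hv
  have hdrop : ∀ n, ∀ v ∈ (p.drop n).support, v ∈ p.support := fun n v hv => by
    rw [SimpleGraph.Walk.drop_support_eq_support_drop_min] at hv
    exact List.mem_of_mem_drop hv
  have hchord : ∀ m n, m < n → n ≤ p.length → G.Adj (p.getVert m) (p.getVert n) →
      s(p.getVert m, p.getVert n) ∈ p.edges := by
    intro m n hmn hn h
    have := hmin _ _ ((p.take m).append (.cons h (p.drop n))) ⟨fun v hv => by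
      rw [SimpleGraph.Walk.mem_support_append_iff, SimpleGraph.Walk.support_cons,
        List.mem_cons] at hv
      rcases hv with hv | rfl | hv
      exacts [hp.1 v (htake m v hv), hp.1 _ (p.getVert_mem_support m), hp.1 v (hdrop n v hv)], hp.2⟩
    rw [SimpleGraph.Walk.length_append, SimpleGraph.Walk.length_cons,
      SimpleGraph.Walk.take_length, SimpleGraph.Walk.drop_length] at this
    obtain rfl : n = m + 1 := by omega
    exact p.mk_mem_edges_iff_exists.mpr ⟨m, by omega, rfl⟩
  refine ⟨⟨x, y, p, hpath, ?_, fun v hv => (hp.1 v hv).2.1, fun v hv => (hp.1 v hv).2.2,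
    ?_, ?_, hp.2.1, hp.2.2⟩, fun v hv => (hp.1 v hv).1⟩
  · intro u hu v hv h
    obtain ⟨m, rfl, hm⟩ := SimpleGraph.Walk.mem_support_iff_exists_getVert.mp hu
    obtain ⟨n, rfl, hn⟩ := SimpleGraph.Walk.mem_support_iff_exists_getVert.mp hv
    rcases lt_trichotomy m n with hmn | rfl | hmn
    · exact hchord m n hmn hn h
    · exact (h.ne rfl).elim
    · rw [Sym2.eq_swap]
      exact hchord n m hmn hm h.symm
  · intro v hv k h
    obtain ⟨m, rfl, hm⟩ := SimpleGraph.Walk.mem_support_iff_exists_getVert.mp hv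
    have := hmin _ _ (p.drop m) ⟨fun v hv => hp.1 v (hdrop m v hv), ⟨k, h⟩, hp.2.2⟩
    rw [SimpleGraph.Walk.drop_length] at this
    obtain rfl | h0 : m = 0 ∨ p.length = 0 := by omega
    · simp
    · obtain rfl : m = 0 := by omega
      simp
  · intro v hv k h
    obtain ⟨m, rfl, hm⟩ := SimpleGraph.Walk.mem_support_iff_exists_getVert.mp hv
    have := hmin _ _ (p.take m) ⟨fun v hv => hp.1 v (htake m v hv), hp.2.1, ⟨k, h⟩⟩
    rw [SimpleGraph.Walk.take_length] at this
    obtain rfl : m = p.length := by omega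
    simp

/-- Disjoint induced rays that no finite set separates and that are not joined by edges have an
infinite sequence of independent links. -/
theorem exists_link_sequence (hG : IsLocallyFinite G) (hP : Function.Injective P)
    (hQ : Function.Injective Q) (hPQ : Disjoint (range P) (range Q))
    (hno : ∀ i j, ¬ G.Adj (P i) (Q j)) (hl : Linked G P Q) :
    ∃ L : ℕ → Link G P Q, ∀ m n, m < n → (L m).Before (L n) := by
  -- These are the neighbours of the ray up to the last attachment of `v`. A later link avoiding
  -- them can attach only strictly after `v`.
  have hfar : ∀ {R : ℕ → V} (_ : Function.Injective R) (v : V),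
      {z | ∃ k k', k' ≤ k ∧ G.Adj v (R k) ∧ G.Adj (R k') z}.Finite := by
    intro R hR v
    have : (⋃ k ∈ {k | G.Adj v (R k)}, ⋃ k' ∈ {k' | k' ≤ k}, G.neighborSet (R k')).Finite :=
      (hG.finite_index hR v).biUnion fun k _ => (finite_le_nat k).biUnion fun k' _ => hG _
    refine this.subset ?_
    rintro z ⟨k, k', h1, h2, h3⟩
    simp only [mem_iUnion]
    exact ⟨k, h2, k', h1, h3⟩
  have hfin : ∀ l : Link G P Q, (l.verts ∪ (⋃ u ∈ l.verts, G.neighborSet u) ∪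
      ({z | ∃ k k', k' ≤ k ∧ G.Adj l.x (P k) ∧ G.Adj (P k') z} ∪
        {z | ∃ k k', k' ≤ k ∧ G.Adj l.y (Q k) ∧ G.Adj (Q k') z})).Finite := by
    intro l
    have hv : l.verts.Finite := List.finite_toSet _
    exact (hv.union (hv.biUnion fun u _ => hG u)).union ((hfar hP _).union (hfar hQ _))
  obtain ⟨L, -, hL⟩ := exists_seq_of_forall_finset_exists (fun _ : Link G P Q => True)
    Link.Before (by
      intro s _
      obtain ⟨l, hlF⟩ := exists_link hPQ hno hl (s.finite_toSet.biUnion fun l _ => hfin l)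
      refine ⟨l, trivial, fun l' hl' => ?_⟩
      have key : ∀ v ∈ l.verts, _ := fun v hv h => hlF v hv (mem_biUnion hl' h)
      refine ⟨fun u hu v hv => ⟨?_, fun h => ?_⟩, fun k k' h h' => ?_, fun k k' h h' => ?_⟩
      · rintro rfl
        exact key u hv (Or.inl (Or.inl hu))
      · exact key v hv (Or.inl (Or.inr (mem_biUnion hu h)))
      · by_contra! hk
        exact key _ l.x_mem (Or.inr (Or.inl ⟨k, k', hk, h, h'.symm⟩))
      · by_contra! hk
        exact key _ l.y_mem (Or.inr (Or.inr ⟨k, k', hk, h, h'.symm⟩)))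
  exact ⟨L, hL⟩

end


/-! ### Rerouting a ray and making attachments uniform -/

/-- An induced ray can be rerouted through vertices `x n` that shortcut disjoint segments. -/
theorem exists_rerouted_ray {G : SimpleGraph V} {P : ℕ → V} (hP : IsInducedRay G P)
    {x : ℕ → V} {a b : ℕ → ℕ} (hx : ∀ n, x n ∉ range P)
    (hxx : ∀ m n, m < n → x m ≠ x n ∧ ¬ G.Adj (x m) (x n))
    (hab : ∀ n, a n + 2 ≤ b n) (hba : ∀ m n, m < n → b m < a n)
    (hxa : ∀ n, G.Adj (x n) (P (a n))) (hxb : ∀ n, G.Adj (x n) (P (b n)))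
    (hxP : ∀ n k, G.Adj (x n) (P k) → a n ≤ k ∧ k ≤ b n) :
    ∃ (P' : ℕ → V) (f : ℕ → ℕ), IsInducedRay G P' ∧ StrictMono f ∧ (∀ n, P' (f n) = x n) ∧
      ∀ k, P' k ∈ range P ∨ ∃ n, P' k = x n := by
  classical
  have tri : ∀ m n, (m < n ∧ b m < a n) ∨ m = n ∨ (n < m ∧ b n < a m) := fun m n => by
    rcases lt_trichotomy m n with h | h | h
    exacts [Or.inl ⟨h, hba _ _ h⟩, Or.inr (Or.inl h), Or.inr (Or.inr ⟨h, hba _ _ h⟩)]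
  have hinj : ∀ m n, a m + 1 = a n + 1 → m = n := fun m n h => by
    have := tri m n; have := hab m; have := hab n; omega
  -- The position `a n + 1` lies strictly between `a n` and `b n`, so it is free to carry `x n`;
  -- from there `nx` jumps to `b n`. The new ray follows `nx` from 0.
  let g : ℕ → V := fun i => if h : ∃ n, i = a n + 1 then x h.choose else P i
  let nx : ℕ → ℕ := fun i => if h : ∃ n, i = a n + 1 then b h.choose else i + 1
  have hg1 : ∀ n, g (a n + 1) = x n := fun n => by
    have h : ∃ m, a n + 1 = a m + 1 := ⟨n, rfl⟩
    simp only [g, dif_pos h, ← hinj _ _ h.choose_spec]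
  have hn1 : ∀ n, nx (a n + 1) = b n := fun n => by
    have h : ∃ m, a n + 1 = a m + 1 := ⟨n, rfl⟩
    simp only [nx, dif_pos h, ← hinj _ _ h.choose_spec]
  have hg2 : ∀ i, (∀ n, i ≠ a n + 1) → g i = P i := fun i h => dif_neg (by simpa using h)
  have hn2 : ∀ i, (∀ n, i ≠ a n + 1) → nx i = i + 1 := fun i h => dif_neg (by simpa using h)
  have cas : ∀ i, (∃ n, i = a n + 1) ∨ ∀ n, i ≠ a n + 1 := fun i => by
    by_cases h : ∃ n, i = a n + 1
    exacts [Or.inl h, Or.inr (by simpa using h)]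
  have hbn : ∀ n m, b n ≠ a m + 1 := fun n m => by
    have := tri m n; have := hab m; have := hab n
    by_cases h : m = n
    · subst h; omega
    · omega
  have hadj : ∀ i, G.Adj (g i) (g (nx i)) := by
    intro i
    rcases cas i with ⟨n, rfl⟩ | h
    · rw [hg1, hn1, hg2 _ (hbn n)]
      exact hxb n
    · rw [hg2 i h, hn2 i h]
      rcases cas (i + 1) with ⟨m, hm⟩ | h'
      · obtain rfl : i = a m := by omega
        rw [hg1]
        exact (hxa m).symm
      · rw [hg2 _ h']
        exact hP.1.2 i
  have hlt : ∀ i, i < nx i := by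
    intro i
    rcases cas i with ⟨n, rfl⟩ | h
    · rw [hn1]; exact hab n
    · rw [hn2 i h]; omega
  have hnadj : ∀ i j, nx i < j → ¬ G.Adj (g i) (g j) := by
    intro i j hij hA
    have hi := hlt i
    rcases cas i with ⟨n, rfl⟩ | h
    · rw [hn1] at hij
      rw [hg1] at hA
      rcases cas j with ⟨m, rfl⟩ | h'
      · rw [hg1] at hA
        have := hab n
        rcases tri n m with ⟨h, -⟩ | rfl | ⟨-, h⟩
        · exact (hxx _ _ h).2 hA
        · omega
        · have := hab m; omega
      · rw [hg2 _ h'] at hA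
        have := hxP _ _ hA
        omega
    · rw [hn2 i h] at hij
      rw [hg2 i h] at hA
      rcases cas j with ⟨m, rfl⟩ | h'
      · rw [hg1] at hA
        have := hxP _ _ hA.symm
        omega
      · rw [hg2 _ h'] at hA
        have := hP.2 _ _ hA
        omega
  have hginj : Function.Injective g := by
    intro i j hij
    rcases cas i with ⟨n, rfl⟩ | h <;> rcases cas j with ⟨m, rfl⟩ | h'
    · rw [hg1, hg1] at hij
      rcases lt_trichotomy n m with h | rfl | h
      exacts [((hxx _ _ h).1 hij).elim, rfl, ((hxx _ _ h).1 hij.symm).elim]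
    · rw [hg1, hg2 _ h'] at hij
      exact (hx n ⟨j, hij.symm⟩).elim
    · rw [hg1, hg2 _ h] at hij
      exact (hx m ⟨i, hij⟩).elim
    · rw [hg2 _ h, hg2 _ h'] at hij
      exact hP.1.1 hij
  let K : ℕ → ℕ := fun n => nx^[n] 0
  have hK : ∀ n, K (n + 1) = nx (K n) := fun n => Function.iterate_succ_apply' nx n 0
  have hKm : StrictMono K := strictMono_nat_of_lt_succ fun n => by rw [hK]; exact hlt _
  -- Jumps skip only positions strictly between some `a n + 1` and `b n`. As the intervals are
  -- disjoint, no `a m + 1` is skipped and every `x m` is visited.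
  have hhit : ∀ m, ∃ j, K j = a m + 1 := by
    intro m
    have hex : ∃ j, a m + 1 < K j := ⟨a m + 2, hKm.le_apply⟩
    obtain ⟨j, hj⟩ : ∃ j, Nat.find hex = j + 1 :=
      Nat.exists_eq_succ_of_ne_zero fun h => by
        have := Nat.find_spec hex
        rw [h] at this
        simp [K] at this
    have h1 : a m + 1 < K (j + 1) := hj ▸ Nat.find_spec hex
    have h2 : K j ≤ a m + 1 := not_lt.mp (Nat.find_min hex (by omega))
    refine ⟨j, ?_⟩
    rw [hK] at h1
    rcases cas (K j) with ⟨n, hn⟩ | h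
    · rw [hn, hn1] at h1
      have := hab m
      rcases tri n m with h | rfl | h
      · omega
      · exact hn
      · omega
    · rw [hn2 _ h] at h1
      omega
  choose f hf using hhit
  have hfar : ∀ i j, i + 1 < j → ¬ G.Adj (g (K i)) (g (K j)) := fun i j hij =>
    hnadj _ _ (by rw [← hK]; exact hKm hij)
  refine ⟨fun n => g (K n), f, ⟨⟨hginj.comp hKm.injective, fun i => by
    dsimp only; rw [hK]; exact hadj _⟩,
    fun i j hij => ?_⟩, fun m n hmn => ?_, fun n => by
    dsimp only; rw [hf, hg1], fun k => ?_⟩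
  · by_contra! h
    rcases lt_trichotomy i j with hlt | rfl | hlt
    · exact hfar i j (by omega) hij
    · exact hij.ne rfl
    · exact hfar j i (by omega) hij.symm
  · rw [← hKm.lt_iff_lt, hf, hf]
    have := hba m n hmn; have := hab m
    omega
  · rcases cas (K k) with ⟨n, hn⟩ | h
    · exact Or.inr ⟨n, by dsimp only; rw [hn, hg1]⟩
    · exact Or.inl ⟨K k, (hg2 _ h).symm⟩

/-- All vertices `x n` have exactly one neighbour on `P` (`δ = 0`), or exactly two, which are
consecutive (`δ = 1`). -/
def AttachedAs (G : SimpleGraph V) (P : ℕ → V) (x : ℕ → V) (δ : ℕ) : Prop :=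
  ∀ n, ∃ a, ∀ k, G.Adj (x n) (P k) ↔ k = a ∨ k = a + δ

/-- A sequence of independent links can be modified at the ray `P` so that all its members are
attached there in the same way, unless there is an induced messy ladder. -/
theorem exists_uniform_left {G : SimpleGraph V} (hG : IsLocallyFinite G) {P Q : ℕ → V}
    (hP : IsInducedRay G P) (hQ : IsInducedRay G Q) (hPQ : Disjoint (range P) (range Q))
    (hno : ∀ i j, ¬ G.Adj (P i) (Q j)) {L : ℕ → Link G P Q}
    (hL : ∀ m n, m < n → (L m).Before (L n)) :
    (∃ S : Set V, IsMessyLadder (G.induce S)) ∨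
    ∃ (P' : ℕ → V) (L' : ℕ → Link G P' Q) (φ : ℕ → ℕ) (δ : ℕ),
      IsInducedRay G P' ∧ Disjoint (range P') (range Q) ∧ (∀ i j, ¬ G.Adj (P' i) (Q j)) ∧
      (∀ m n, m < n → (L' m).Before (L' n)) ∧ (∀ n, (L' n).y = (L (φ n)).y) ∧
      δ ≤ 1 ∧ AttachedAs G P' (fun n => (L' n).x) δ := by
  classical
  have hfin : ∀ n, {k | G.Adj (L n).x (P k)}.Finite := fun n => hG.finite_index hP.1.1 _
  have hlo : ∀ n, ∃ a, G.Adj (L n).x (P a) ∧ ∀ k, G.Adj (L n).x (P k) → a ≤ k := fun n =>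
    ⟨Nat.find (L n).exists_left, Nat.find_spec (L n).exists_left,
      fun k hk => Nat.find_min' _ hk⟩
  have hhi : ∀ n, ∃ b, G.Adj (L n).x (P b) ∧ ∀ k, G.Adj (L n).x (P k) → k ≤ b := fun n => by
    obtain ⟨b, hb, hmax⟩ := (hfin n).exists_maximal (L n).exists_left
    refine ⟨b, hb, fun k hk => ?_⟩
    rcases le_total k b with h | h
    exacts [h, hmax hk h]
  choose a ha halo using hlo
  choose b hb hbhi using hhi
  have hle : ∀ n, a n ≤ b n := fun n => halo n _ (hb n)
  have hba : ∀ m n, m < n → b m < a n := fun m n hmn => (hL m n hmn).2.1 _ _ (hb m) (ha n)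
  -- Either the extreme attachments coincide or are consecutive infinitely often, and a subsequence
  -- is uniform, or almost all links span a gap that can be shortcut.
  by_cases hsmall : ∀ δ ≤ 1, ¬ ∃ᶠ n in Filter.atTop, b n = a n + δ
  swap
  · push Not at hsmall
    obtain ⟨δ, hδ, hfr⟩ := hsmall
    obtain ⟨φ, hφ, hφδ⟩ := Filter.extraction_of_frequently_atTop hfr
    refine Or.inr ⟨P, fun n => L (φ n), φ, δ, hP, hPQ, hno, fun m n hmn => hL _ _ (hφ hmn),
      fun _ => rfl, hδ, fun n => ⟨a (φ n), fun k => ⟨fun h => ?_, ?_⟩⟩⟩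
    · have := halo _ _ h; have := hbhi _ _ h; have := hφδ n
      omega
    · rintro (rfl | rfl)
      exacts [ha _, hφδ n ▸ hb _]
  have hbig : ∃ᶠ n in Filter.atTop, a n + 2 ≤ b n := by
    have h0 := Filter.not_frequently.mp (hsmall 0 (by omega))
    have h1 := Filter.not_frequently.mp (hsmall 1 (by omega))
    refine ((h0.and h1).mono fun n hn => ?_).frequently
    have := hle n; have := hn.1; have := hn.2
    omega
  have hoff : ∀ n, (L n).x ∉ range P := fun n => (L n).off_left _ (L n).x_mem
  have hxx : ∀ m n, m < n → (L m).x ≠ (L n).x ∧ ¬ G.Adj (L m).x (L n).x := fun m n hmn =>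
    (hL m n hmn).1 _ (L m).x_mem _ (L n).x_mem
  have reroute : ∀ φ : ℕ → ℕ, StrictMono φ → (∀ n, a (φ n) + 2 ≤ b (φ n)) →
      ∃ (P' : ℕ → V) (f : ℕ → ℕ), IsInducedRay G P' ∧ StrictMono f ∧
        (∀ n, P' (f n) = (L (φ n)).x) ∧ (∀ k, P' k ∈ range P ∨ ∃ n, P' k = (L (φ n)).x) ∧
        Disjoint (range P') (range Q) := by
    intro φ hφ hφ2
    obtain ⟨P', f, h1, h2, h3, h4⟩ := exists_rerouted_ray hP (x := fun n => (L (φ n)).x)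
      (a := fun n => a (φ n)) (b := fun n => b (φ n)) (fun n => hoff _)
      (fun m n h => hxx _ _ (hφ h)) hφ2 (fun m n h => hba _ _ (hφ h)) (fun n => ha _)
      (fun n => hb _) (fun n k h => ⟨halo _ _ h, hbhi _ _ h⟩)
    refine ⟨P', f, h1, h2, h3, h4, ?_⟩
    rw [disjoint_left]
    rintro _ ⟨k, rfl⟩ hk
    rcases h4 k with h | ⟨n, h⟩
    · exact disjoint_left.mp hPQ h hk
    · rw [h] at hk
      exact (L (φ n)).off_right _ (L (φ n)).x_mem hk
  -- A one-vertex link absorbed by the rerouted ray turns into an edge from that ray to `Q`.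
  by_cases htriv : ∃ᶠ n in Filter.atTop, a n + 2 ≤ b n ∧ (L n).x = (L n).y
  · left
    obtain ⟨φ, hφ, hφ2⟩ := Filter.extraction_of_frequently_atTop htriv
    obtain ⟨P', f, h1, h2, h3, -, h5⟩ := reroute φ hφ fun n => (hφ2 n).1
    refine exists_messyLadder hG h1 hQ h5 ((infinite_range_of_injective h2.injective).mono ?_)
    rintro _ ⟨n, rfl⟩
    obtain ⟨j, hj⟩ := (L (φ n)).exists_right
    exact ⟨j, by rw [h3, (hφ2 n).2]; exact hj⟩
  right
  have hlong : ∃ᶠ n in Filter.atTop, a n + 2 ≤ b n ∧ (L n).x ≠ (L n).y :=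
    (hbig.and_eventually (Filter.not_frequently.mp htriv)).mono fun n hn =>
      ⟨hn.1, fun h => hn.2 ⟨hn.1, h⟩⟩
  obtain ⟨φ, hφ, hφ2⟩ := Filter.extraction_of_frequently_atTop hlong
  obtain ⟨P', f, h1, h2, h3, h4, h5⟩ := reroute φ hφ fun n => (hφ2 n).1
  have hsep : ∀ m n, m ≠ n → ∀ u ∈ (L (φ m)).verts, ∀ v ∈ (L (φ n)).verts,
      u ≠ v ∧ ¬ G.Adj u v := by
    intro m n hmn u hu v hv
    rcases lt_or_gt_of_ne hmn with h | h
    · exact (hL _ _ (hφ h)).1 u hu v hv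
    · obtain ⟨e1, e2⟩ := (hL _ _ (hφ h)).1 v hv u hu
      exact ⟨e1.symm, fun h => e2 h.symm⟩
  -- Drop the first vertex `x`, which now lies on `P'`. The rest of the link has no neighbour on
  -- `P`, none among the vertices of other links, and by chordlessness only its first vertex is
  -- adjacent to `x`.
  have hshort : ∀ n, ∃ l : Link G P' Q, l.y = (L (φ n)).y ∧ l.verts ⊆ (L (φ n)).verts ∧
      ∀ k, G.Adj l.x (P' k) ↔ k = f n := by
    intro n
    have hsep' := fun m (h : m ≠ n) => hsep m n h
    have hne := (hφ2 n).2
    have h3' := h3 n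
    generalize L (φ n) = l at hsep' hne h3'
    obtain ⟨x, y, w, w1, w2, w3, w4, w5, w6, w7, w8⟩ := l
    cases w with
    | nil => exact (hne rfl).elim
    | @cons _ x' _ h q =>
      rw [SimpleGraph.Walk.cons_isPath_iff] at w1
      have hq : ∀ v ∈ q.support, v ∈ (SimpleGraph.Walk.cons h q).support := fun v hv =>
        List.mem_cons_of_mem _ hv
      have hx' : ∀ v ∈ q.support, G.Adj v x → v = x' := by
        intro v hv hvx
        have := w2 _ (hq v hv) _ (SimpleGraph.Walk.start_mem_support _) hvx
        rw [SimpleGraph.Walk.edges_cons, List.mem_cons] at this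
        rcases this with e | e
        · rcases Sym2.eq_iff.mp e with ⟨rfl, -⟩ | ⟨e, -⟩
          exacts [(w1.2 hv).elim, e]
        · exact (w1.2 (q.snd_mem_support_of_mem_edges e)).elim
      have hadj : ∀ v ∈ q.support, ∀ k, G.Adj v (P' k) → v = x' ∧ k = f n := by
        intro v hv k hvk
        rcases h4 k with ⟨i, hi⟩ | ⟨m, hm⟩
        · rw [← hi] at hvk
          exact (w1.2 (w5 v (hq v hv) i hvk ▸ hv)).elim
        · by_cases hmn : m = n
          · subst hmn
            rw [← h3, h3'] at hm
            change P' k = x at hm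
            refine ⟨hx' v hv (hm ▸ hvk), h1.1.1 (hm.trans h3'.symm)⟩
          · rw [hm] at hvk
            exact ((hsep' m hmn _ (L (φ m)).x_mem v (hq v hv)).2 hvk.symm).elim
      have hfx : G.Adj x' (P' (f n)) := by rw [h3']; exact h.symm
      refine ⟨⟨x', y, q, w1.1, fun u hu v hv huv => ?_, fun v hv => ?_,
        fun v hv => w4 v (hq v hv), fun v hv k hk => (hadj v hv k hk).1,
        fun v hv k hk => w6 v (hq v hv) k hk, ⟨f n, hfx⟩, w8⟩, rfl, hq,
        fun k => ⟨fun hk => (hadj x' q.start_mem_support k hk).2, ?_⟩⟩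
      · have := w2 u (hq u hu) v (hq v hv) huv
        rw [SimpleGraph.Walk.edges_cons, List.mem_cons] at this
        rcases this with e | e
        · rcases Sym2.eq_iff.mp e with ⟨rfl, -⟩ | ⟨-, rfl⟩
          exacts [(w1.2 hu).elim, (w1.2 hv).elim]
        · exact e
      · rintro ⟨k, rfl⟩
        rcases h4 k with hi | ⟨m, hm⟩
        · exact w3 _ (hq _ hv) hi
        · by_cases hmn : m = n
          · subst hmn
            rw [← h3, h3'] at hm
            change P' k = x at hm
            exact w1.2 (hm ▸ hv)
          · exact (hsep' m hmn _ (L (φ m)).x_mem _ (hq _ hv)).1 hm.symm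
      · rintro rfl
        exact hfx
  choose L' hy hv hk using hshort
  refine ⟨P', L', φ, 0, h1, h5, fun i j hij => ?_, fun m n hmn => ⟨fun u hu v hv' => ?_,
    fun k k' h h' => ?_, fun k k' h h' => ?_⟩, hy, by omega,
    fun n => ⟨f n, fun k => by simp [hk]⟩⟩
  -- A vertex `x` on `P'` differs from the end `y` of its link, hence has no neighbour on `Q`.
  · rcases h4 i with ⟨i', hi⟩ | ⟨m, hm⟩
    · exact hno i' j (hi ▸ hij)
    · rw [hm] at hij
      exact (hφ2 m).2 ((L (φ m)).adj_right _ (L (φ m)).x_mem _ hij)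
  · exact hsep m n hmn.ne u (hv m hu) v (hv n hv')
  · rw [hk] at h h'
    rw [h, h']
    exact h2 hmn
  · rw [hy] at h h'
    exact (hL _ _ (hφ hmn)).2.2 k k' h h'


/-! ### Ties formed by links, and their types -/

section OffRails

variable {G : SimpleGraph V} {P Q : ℕ → V}

lemma offRails_adj {u v : V} :
    (offRails G P Q).Adj u v ↔ G.Adj u v ∧ s(u, v) ∉ rayEdges P ∪ rayEdges Q := by
  simp only [offRails, SimpleGraph.deleteEdges_adj]

lemma notMem_rayEdges {R : ℕ → V} {u v : V} (hv : v ∉ range R) : s(u, v) ∉ rayEdges R := by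
  rintro ⟨i, hi⟩
  rcases Sym2.eq_iff.mp hi with ⟨-, rfl⟩ | ⟨rfl, -⟩
  exacts [hv ⟨_, rfl⟩, hv ⟨_, rfl⟩]

lemma offRails_adj_of_adj {u v : V} (h : G.Adj u v) (hP : v ∉ range P) (hQ : v ∉ range Q) :
    (offRails G P Q).Adj u v :=
  offRails_adj.mpr ⟨h, fun e => e.elim (notMem_rayEdges hP) (notMem_rayEdges hQ)⟩

lemma IsInducedRay.mem_rayEdges {R : ℕ → V} (hR : IsInducedRay G R) {i j : ℕ}
    (h : G.Adj (R i) (R j)) : s(R i, R j) ∈ rayEdges R := by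
  rcases hR.2 _ _ h with rfl | rfl
  exacts [⟨i, rfl⟩, ⟨j, Sym2.eq_swap⟩]

/-- The edges outside the rails have an end outside the rails. -/
lemma off_or_off_of_offRails_adj (hP : IsInducedRay G P) (hQ : IsInducedRay G Q)
    (hno : ∀ i j, ¬ G.Adj (P i) (Q j)) {u v : V} (h : (offRails G P Q).Adj u v) :
    (u ∉ range P ∧ u ∉ range Q) ∨ (v ∉ range P ∧ v ∉ range Q) := by
  rw [offRails_adj] at h
  obtain ⟨h, hs⟩ := h
  by_contra! hcon
  have hu : u ∈ range P ∨ u ∈ range Q := or_iff_not_imp_left.mpr hcon.1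
  have hv : v ∈ range P ∨ v ∈ range Q := or_iff_not_imp_left.mpr hcon.2
  rcases hu with ⟨i, rfl⟩ | ⟨i, rfl⟩ <;> rcases hv with ⟨j, rfl⟩ | ⟨j, rfl⟩
  · exact hs (Or.inl (hP.mem_rayEdges h))
  · exact hno _ _ h
  · exact hno _ _ h.symm
  · exact hs (Or.inr (hQ.mem_rayEdges h))

end OffRails

/-- The vertex set `J` consists of a link and of its neighbours `P a`, `P (a + δ)` and
`Q b`, `Q (b + ε)` on the rays. -/
def IsLinkTie (G : SimpleGraph V) (P Q : ℕ → V) (δ ε : ℕ) (J : Set V) : Prop :=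
  ∃ (l : Link G P Q) (a b : ℕ), (∀ k, G.Adj l.x (P k) ↔ k = a ∨ k = a + δ) ∧
    (∀ k, G.Adj l.y (Q k) ↔ k = b ∨ k = b + ε) ∧
    J = l.verts ∪ {P a, P (a + δ)} ∪ {Q b, Q (b + ε)}

namespace Link

variable {G : SimpleGraph V} {P Q : ℕ → V}

lemma exists_walk_offRails (l : Link G P Q) :
    ∃ w : (offRails G P Q).Walk l.x l.y,
      w.IsPath ∧ w.support = l.walk.support ∧ w.edges = l.walk.edges := by
  have h : ∀ e ∈ l.walk.edges, e ∈ (offRails G P Q).edgeSet := by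
    intro e
    induction e using Sym2.ind with
    | _ u v =>
      intro he
      have hv := l.walk.snd_mem_support_of_mem_edges he
      exact offRails_adj_of_adj (l.walk.adj_of_mem_edges he) (l.off_left v hv) (l.off_right v hv)
  exact ⟨l.walk.transfer _ h, l.isPath.transfer h, l.walk.support_transfer h,
    l.walk.edges_transfer h⟩

variable (l : Link G P Q) {a b δ ε : ℕ}

lemma inter_range_left (hPQ : Disjoint (range P) (range Q)) :
    (l.verts ∪ {P a, P (a + δ)} ∪ {Q b, Q (b + ε)}) ∩ range P = {P a, P (a + δ)} := by
  ext v
  constructor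
  · rintro ⟨(h | h) | h, hv⟩
    · exact (l.off_left v h hv).elim
    · exact h
    · rcases h with rfl | rfl
      exacts [(disjoint_left.mp hPQ hv ⟨_, rfl⟩).elim, (disjoint_left.mp hPQ hv ⟨_, rfl⟩).elim]
  · intro h
    refine ⟨Or.inl (Or.inr h), ?_⟩
    rcases h with rfl | rfl
    exacts [⟨_, rfl⟩, ⟨_, rfl⟩]

lemma inter_range_right (hPQ : Disjoint (range P) (range Q)) :
    (l.verts ∪ {P a, P (a + δ)} ∪ {Q b, Q (b + ε)}) ∩ range Q = {Q b, Q (b + ε)} := by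
  have := l.reverse.inter_range_left (a := b) (δ := ε) (b := a) (ε := δ) hPQ.symm
  rwa [verts_reverse, union_right_comm] at this

/-- An edge off the rails has an end off the rails, hence on the link; chordlessness and the
attachment conditions then leave only the listed edges. -/
lemma offRails_adj_iff (hP : IsInducedRay G P) (hQ : IsInducedRay G Q)
    (hno : ∀ i j, ¬ G.Adj (P i) (Q j))
    (ha : ∀ k, G.Adj l.x (P k) ↔ k = a ∨ k = a + δ)
    (hb : ∀ k, G.Adj l.y (Q k) ↔ k = b ∨ k = b + ε) :
    ∀ u ∈ l.verts ∪ {P a, P (a + δ)} ∪ {Q b, Q (b + ε)},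
    ∀ v ∈ l.verts ∪ {P a, P (a + δ)} ∪ {Q b, Q (b + ε)},
      (offRails G P Q).Adj u v ↔ s(u, v) ∈ l.walk.edges ∨ s(u, v) = s(P a, l.x) ∨
        s(u, v) = s(P (a + δ), l.x) ∨ s(u, v) = s(Q b, l.y) ∨ s(u, v) = s(Q (b + ε), l.y) := by
  have key : ∀ u v, u ∈ l.verts → v ∈ l.verts ∪ {P a, P (a + δ)} ∪ {Q b, Q (b + ε)} →
      G.Adj u v → s(u, v) ∈ l.walk.edges ∨ s(u, v) = s(P a, l.x) ∨
        s(u, v) = s(P (a + δ), l.x) ∨ s(u, v) = s(Q b, l.y) ∨ s(u, v) = s(Q (b + ε), l.y) := by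
    rintro u v hu ((hv | rfl | rfl) | rfl | rfl) h
    · exact Or.inl (l.chordless u hu v hv h)
    · rw [l.adj_left u hu _ h, Sym2.eq_swap]; tauto
    · rw [l.adj_left u hu _ h, Sym2.eq_swap]; tauto
    · rw [l.adj_right u hu _ h, Sym2.eq_swap]; tauto
    · rw [l.adj_right u hu _ h, Sym2.eq_swap]; tauto
  intro u hu v hv
  constructor
  · intro h
    have hG := (offRails_adj.mp h).1
    have honly : ∀ z ∈ l.verts ∪ {P a, P (a + δ)} ∪ {Q b, Q (b + ε)}, z ∉ range P ∧ z ∉ range Q →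
        z ∈ l.verts := by
      rintro z ((hz | rfl | rfl) | rfl | rfl) ⟨h1, h2⟩
      exacts [hz, (h1 ⟨_, rfl⟩).elim, (h1 ⟨_, rfl⟩).elim, (h2 ⟨_, rfl⟩).elim, (h2 ⟨_, rfl⟩).elim]
    rcases off_or_off_of_offRails_adj hP hQ hno h with h' | h'
    · exact key u v (honly u hu h') hv hG
    · rw [Sym2.eq_swap]
      exact key v u (honly v hv h') hu hG.symm
  · have hx := l.off_left _ l.x_mem
    have hx' := l.off_right _ l.x_mem
    have hy := l.off_left _ l.y_mem
    have hy' := l.off_right _ l.y_mem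
    rw [← SimpleGraph.mem_edgeSet]
    rintro (h | h | h | h | h)
    · have hv := l.walk.snd_mem_support_of_mem_edges h
      exact offRails_adj_of_adj (l.walk.adj_of_mem_edges h) (l.off_left v hv) (l.off_right v hv)
    all_goals rw [h, SimpleGraph.mem_edgeSet]
    · exact offRails_adj_of_adj ((ha a).mpr (Or.inl rfl)).symm hx hx'
    · exact offRails_adj_of_adj ((ha _).mpr (Or.inr rfl)).symm hx hx'
    · exact offRails_adj_of_adj ((hb b).mpr (Or.inl rfl)).symm hy hy'
    · exact offRails_adj_of_adj ((hb _).mpr (Or.inr rfl)).symm hy hy'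

end Link

section Types

variable {G : SimpleGraph V} {P Q : ℕ → V} {J : Set V}

lemma IsLinkTie.isTypeYLambda (hP : IsInducedRay G P) (hQ : IsInducedRay G Q)
    (hPQ : Disjoint (range P) (range Q)) (hno : ∀ i j, ¬ G.Adj (P i) (Q j))
    (h : IsLinkTie G P Q 1 1 J) : IsTypeYLambda G P Q J := by
  obtain ⟨l, a, b, ha, hb, rfl⟩ := h
  obtain ⟨w, hw, hws, hwe⟩ := l.exists_walk_offRails
  refine ⟨a, b, l.x, l.y, w, hw, ?_, l.inter_range_left hPQ, l.inter_range_right hPQ, ?_, ?_⟩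
  · rw [hws]
    exact fun x hx h => h.elim (l.off_left x hx) (l.off_right x hx)
  · rw [hws]; rfl
  · rw [hwe]
    exact l.offRails_adj_iff hP hQ hno ha hb

/-- In types `I` and `Y` the path of the tie includes its attachment on `Q`, whereas a link stops
just before it. -/
lemma Link.exists_walk_concat (l : Link G P Q) {b : ℕ} (hb : G.Adj l.y (Q b)) :
    ∃ w : (offRails G P Q).Walk l.x (Q b), w.IsPath ∧ w.support = l.walk.support ++ [Q b] ∧
      w.edges = l.walk.edges ++ [s(l.y, Q b)] := by
  obtain ⟨w, hw, hws, hwe⟩ := l.exists_walk_offRails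
  have hadj : (offRails G P Q).Adj l.y (Q b) :=
    (offRails_adj_of_adj hb.symm (l.off_left _ l.y_mem) (l.off_right _ l.y_mem)).symm
  refine ⟨w.concat hadj, hw.concat ?_ hadj, ?_, ?_⟩
  · rw [hws]
    exact fun h => l.off_right _ h ⟨b, rfl⟩
  · rw [SimpleGraph.Walk.support_concat, hws]
  · rw [SimpleGraph.Walk.edges_concat, hwe, List.concat_eq_append]

lemma IsLinkTie.isTypeY (hP : IsInducedRay G P) (hQ : IsInducedRay G Q)
    (hPQ : Disjoint (range P) (range Q)) (hno : ∀ i j, ¬ G.Adj (P i) (Q j))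
    (h : IsLinkTie G P Q 1 0 J) : IsTypeY G P Q J := by
  obtain ⟨l, a, b, ha, hb, rfl⟩ := h
  have hby : G.Adj l.y (Q b) := (hb b).mpr (Or.inl rfl)
  obtain ⟨w, hw, hws, hwe⟩ := l.exists_walk_concat hby
  have hoff : ∀ k, P k ∉ w.support := by
    intro k hk
    rw [hws, List.mem_append, List.mem_singleton] at hk
    rcases hk with hk | hk
    exacts [l.off_left _ hk ⟨k, rfl⟩, disjoint_left.mp hPQ ⟨k, rfl⟩ ⟨b, hk.symm⟩]
  refine ⟨a, b, l.x, w, hw, fun h => h.elim (l.off_left _ l.x_mem) (l.off_right _ l.x_mem),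
    l.inter_range_left hPQ, ?_, ?_, hoff _, hoff _, fun x hx y hy => ?_⟩
  · rw [l.inter_range_right hPQ]; simp
  · rw [hws]
    ext v
    simp only [Link.verts, mem_union, mem_ofPred_eq, mem_insert_iff, mem_singleton_iff,
      List.mem_append, List.mem_singleton, add_zero]
    tauto
  · rw [l.offRails_adj_iff hP hQ hno ha hb x hx y hy, hwe, List.mem_append, List.mem_singleton,
      add_zero, Sym2.eq_swap (a := l.y)]
    tauto

lemma IsLinkTie.isTypeI (hP : IsInducedRay G P) (hQ : IsInducedRay G Q)
    (hPQ : Disjoint (range P) (range Q)) (hno : ∀ i j, ¬ G.Adj (P i) (Q j))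
    (h : IsLinkTie G P Q 0 0 J) : IsTypeI G P Q J := by
  obtain ⟨l, a, b, ha, hb, rfl⟩ := h
  have hby : G.Adj l.y (Q b) := (hb b).mpr (Or.inl rfl)
  obtain ⟨w, hw, hws, hwe⟩ := l.exists_walk_concat hby
  have hadj : (offRails G P Q).Adj (P a) l.x :=
    offRails_adj_of_adj ((ha a).mpr (Or.inl rfl)).symm (l.off_left _ l.x_mem)
      (l.off_right _ l.x_mem)
  refine ⟨a, b, .cons hadj w, hw.cons ?_, ?_, ?_, ?_, fun x hx y hy h => ?_⟩
  · intro hk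
    rw [hws, List.mem_append, List.mem_singleton] at hk
    rcases hk with hk | hk
    exacts [l.off_left _ hk ⟨a, rfl⟩, disjoint_left.mp hPQ ⟨a, rfl⟩ ⟨b, hk.symm⟩]
  · rw [l.inter_range_left hPQ]; simp
  · rw [l.inter_range_right hPQ]; simp
  · rw [SimpleGraph.Walk.support_cons, hws]
    ext v
    simp only [Link.verts, mem_union, mem_ofPred_eq, mem_insert_iff, mem_singleton_iff,
      List.mem_append, List.mem_cons, add_zero]
    tauto
  · rw [l.offRails_adj_iff hP hQ hno ha hb x hx y hy, add_zero, add_zero] at h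
    rw [SimpleGraph.Walk.edges_cons, hwe, List.mem_cons, List.mem_append, List.mem_singleton,
      Sym2.eq_swap (a := l.y)]
    tauto

end Types

/-! ### Assembling the ladder -/

lemma IsTieLadder.imp {G : SimpleGraph V} {P Q : ℕ → V} {τ τ' : Set V → Prop}
    (h : IsTieLadder G P Q τ) (hτ : ∀ J, τ J → τ' J) : IsTieLadder G P Q τ' :=
  ⟨h.1, h.2.1, h.2.2.1, h.2.2.2.1, h.2.2.2.2.1, fun J hJ => hτ J (h.2.2.2.2.2.1 J hJ),
    h.2.2.2.2.2.2⟩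

/-- Two rails and a uniform sequence of independent links covering the graph form a ladder. -/
theorem isTieLadder_of_links {G : SimpleGraph V} {P Q : ℕ → V} (hP : IsInducedRay G P)
    (hQ : IsInducedRay G Q) (hPQ : Disjoint (range P) (range Q))
    (hno : ∀ i j, ¬ G.Adj (P i) (Q j)) {L : ℕ → Link G P Q}
    (hL : ∀ m n, m < n → (L m).Before (L n)) {δ ε : ℕ} {a b : ℕ → ℕ}
    (ha : ∀ n k, G.Adj (L n).x (P k) ↔ k = a n ∨ k = a n + δ)
    (hb : ∀ n k, G.Adj (L n).y (Q k) ↔ k = b n ∨ k = b n + ε)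
    (ha0 : a 0 = 0) (hb0 : b 0 = 0)
    (hcov : ∀ v, v ∉ range P → v ∉ range Q → ∃ n, v ∈ (L n).verts) :
    IsTieLadder G P Q (IsLinkTie G P Q δ ε) := by
  classical
  let J : ℕ → Set V := fun n =>
    (L n).verts ∪ {P (a n), P (a n + δ)} ∪ {Q (b n), Q (b n + ε)}
  have hPJ : ∀ n k, G.Adj (L n).x (P k) → P k ∈ J n := by
    intro n k h
    rcases (ha n k).mp h with rfl | rfl
    exacts [Or.inl (Or.inr (Or.inl rfl)), Or.inl (Or.inr (Or.inr rfl))]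
  have hQJ : ∀ n k, G.Adj (L n).y (Q k) → Q k ∈ J n := by
    intro n k h
    rcases (hb n k).mp h with rfl | rfl
    exacts [Or.inr (Or.inl rfl), Or.inr (Or.inr rfl)]
  have hJ : ∀ n v, v ∈ J n → v ∈ (L n).verts ∨ (∃ k, G.Adj (L n).x (P k) ∧ P k = v) ∨
      ∃ k, G.Adj (L n).y (Q k) ∧ Q k = v := by
    rintro n v ((h | rfl | rfl) | rfl | rfl)
    · exact Or.inl h
    · exact Or.inr (Or.inl ⟨_, (ha n _).mpr (Or.inl rfl), rfl⟩)
    · exact Or.inr (Or.inl ⟨_, (ha n _).mpr (Or.inr rfl), rfl⟩)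
    · exact Or.inr (Or.inr ⟨_, (hb n _).mpr (Or.inl rfl), rfl⟩)
    · exact Or.inr (Or.inr ⟨_, (hb n _).mpr (Or.inr rfl), rfl⟩)
  have hPa : ∀ n, P (a n) ∈ J n := fun n => hPJ n _ ((ha n _).mpr (Or.inl rfl))
  have hQb : ∀ n, Q (b n) ∈ J n := fun n => hQJ n _ ((hb n _).mpr (Or.inl rfl))
  have hdis : ∀ m n, m < n → Disjoint (J m) (J n) := by
    intro m n hmn
    rw [disjoint_left]
    intro v hm hn
    have hne : ∀ i j, P i ≠ Q j := fun i j h => disjoint_left.mp hPQ ⟨i, rfl⟩ ⟨j, h.symm⟩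
    rcases hJ m v hm with h | ⟨k, h, rfl⟩ | ⟨k, h, rfl⟩ <;>
      rcases hJ n _ hn with h' | ⟨k', h', e⟩ | ⟨k', h', e⟩
    · exact ((hL m n hmn).1 v h v h').1 rfl
    · exact (L m).off_left v h ⟨k', e⟩
    · exact (L m).off_right v h ⟨k', e⟩
    · exact (L n).off_left _ h' ⟨k, rfl⟩
    · have := (hL m n hmn).2.1 _ _ h h'
      have := hP.1.1 e
      omega
    · exact hne _ _ e.symm
    · exact (L n).off_right _ h' ⟨k, rfl⟩
    · exact hne _ _ e
    · have := (hL m n hmn).2.2 _ _ h h'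
      have := hQ.1.1 e
      omega
  have hdis' : ∀ m n v, v ∈ J m → v ∈ J n → m = n := by
    intro m n v hm hn
    rcases lt_trichotomy m n with h | h | h
    exacts [(disjoint_left.mp (hdis m n h) hm hn).elim, h,
      (disjoint_left.mp (hdis n m h) hn hm).elim]
  -- Distinct links are not adjacent, so no edge off the rails leaves a set `J n`. As each `J n` is
  -- also connected off the rails, it is a component.
  have hedge : ∀ u v, (offRails G P Q).Adj u v → ∃ n, u ∈ J n ∧ v ∈ J n := by
    have key : ∀ u v, G.Adj u v → u ∉ range P → u ∉ range Q → ∃ n, u ∈ J n ∧ v ∈ J n := by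
      intro u v h h1 h2
      obtain ⟨n, hn⟩ := hcov u h1 h2
      refine ⟨n, Or.inl (Or.inl hn), ?_⟩
      by_cases hvP : v ∈ range P
      · obtain ⟨k, rfl⟩ := hvP
        have := (L n).adj_left u hn k h
        subst this
        exact hPJ n k h
      by_cases hvQ : v ∈ range Q
      · obtain ⟨k, rfl⟩ := hvQ
        have := (L n).adj_right u hn k h
        subst this
        exact hQJ n k h
      obtain ⟨m, hm⟩ := hcov v hvP hvQ
      rcases lt_trichotomy m n with hmn | rfl | hmn
      · exact (((hL _ _ hmn).1 v hm u hn).2 h.symm).elim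
      · exact Or.inl (Or.inl hm)
      · exact (((hL _ _ hmn).1 u hn v hm).2 h).elim
    intro u v h
    have hG := (offRails_adj.mp h).1
    rcases off_or_off_of_offRails_adj hP hQ hno h with h' | h'
    · exact key u v hG h'.1 h'.2
    · obtain ⟨n, h1, h2⟩ := key v u hG.symm h'.1 h'.2
      exact ⟨n, h2, h1⟩
  have hclosed : ∀ n u v, (offRails G P Q).Reachable u v → u ∈ J n → v ∈ J n := by
    rintro n u v ⟨w⟩
    induction w with
    | nil => exact id
    | cons h _ ih =>
      intro hu
      obtain ⟨m, h1, h2⟩ := hedge _ _ h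
      obtain rfl := hdis' _ _ _ h1 hu
      exact ih h2
  have hreach : ∀ n v, v ∈ J n → (offRails G P Q).Reachable (L n).x v := by
    intro n v hv
    obtain ⟨w, -, hws, -⟩ := (L n).exists_walk_offRails
    have hin : ∀ v ∈ (L n).verts, (offRails G P Q).Reachable (L n).x v := fun v hv =>
      ⟨w.takeUntil v (by rw [hws]; exact hv)⟩
    rcases hJ n v hv with h | ⟨k, h, rfl⟩ | ⟨k, h, rfl⟩
    · exact hin v h
    · exact (offRails_adj_of_adj h.symm ((L n).off_left _ (L n).x_mem)
        ((L n).off_right _ (L n).x_mem)).reachable.symm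
    · exact (hin _ (L n).y_mem).trans (offRails_adj_of_adj h.symm ((L n).off_left _ (L n).y_mem)
        ((L n).off_right _ (L n).y_mem)).reachable.symm
  have hsupp : ∀ n v, v ∈ J n → ((offRails G P Q).connectedComponentMk v).supp = J n := by
    intro n v hv
    ext u
    rw [SimpleGraph.ConnectedComponent.mem_supp_iff, SimpleGraph.ConnectedComponent.eq]
    exact ⟨fun h => hclosed n v u h.symm hv, fun hu => (hreach n u hu).symm.trans (hreach n v hv)⟩
  have htie : ∀ n, IsTie G P Q (J n) := fun n =>
    ⟨⟨_, hsupp n _ (hPa n)⟩, ⟨_, hPa n, ⟨_, rfl⟩⟩, ⟨_, hQb n, ⟨_, rfl⟩⟩⟩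
  -- A component meeting both rays contains an edge, which places it among the sets `J n`.
  have htie' : ∀ T, IsTie G P Q T → ∃ n, J n = T := by
    rintro T ⟨⟨c, rfl⟩, ⟨_, hp, ⟨i, rfl⟩⟩, ⟨_, hq, ⟨j, rfl⟩⟩⟩
    rw [SimpleGraph.ConnectedComponent.mem_supp_iff] at hp hq
    obtain ⟨w⟩ := SimpleGraph.ConnectedComponent.exact (hp.trans hq.symm)
    have hne : P i ≠ Q j := fun h => disjoint_left.mp hPQ ⟨i, rfl⟩ ⟨j, h.symm⟩
    subst hp
    generalize P i = p at *
    cases w with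
    | nil => exact (hne rfl).elim
    | cons h _ =>
      obtain ⟨n, h1, -⟩ := hedge _ _ h
      exact ⟨n, (hsupp n _ h1).symm⟩
  have hinj : Function.Injective J := fun m n h => hdis' m n _ (hPa m) (h ▸ hPa m)
  refine ⟨hP, hQ, hPQ, fun x hx => ?_, fun x y h => ?_, fun T hT => ?_, ?_, ?_, ?_⟩
  · obtain ⟨n, hn⟩ := hcov x (fun h => hx (Or.inl h)) (fun h => hx (Or.inr h))
    exact ⟨J n, htie n, Or.inl (Or.inl hn)⟩
  · obtain ⟨n, hn⟩ := hedge x y h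
    exact ⟨J n, htie n, hn⟩
  · obtain ⟨n, rfl⟩ := htie' T hT
    exact ⟨L n, a n, b n, ha n, hb n, rfl⟩
  · exact (infinite_range_of_injective hinj).mono (by rintro _ ⟨n, rfl⟩; exact htie n)
  · rintro T₁ T₂ h₁ h₂ hne hcross
    obtain ⟨m, rfl⟩ := htie' _ h₁
    obtain ⟨n, rfl⟩ := htie' _ h₂
    have hlt : ∀ m n, m < n → a m < a n ∧ b m < b n := fun m n hmn =>
      ⟨(hL m n hmn).2.1 _ _ ((ha m _).mpr (Or.inl rfl)) ((ha n _).mpr (Or.inl rfl)),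
        (hL m n hmn).2.2 _ _ ((hb m _).mpr (Or.inl rfl)) ((hb n _).mpr (Or.inl rfl))⟩
    have hmn : m ≠ n := fun h => hne (by rw [h])
    rcases lt_or_gt_of_ne hmn with h | h <;> have h3 := hlt _ _ h <;>
      rcases hcross with ⟨h1, h2⟩ | ⟨h1, h2⟩ <;>
      have e1 := h1 _ _ (hPa _) (hPa _) <;> have e2 := h2 _ _ (hQb _) (hQb _) <;> omega
  · have h1 := hPa 0
    have h2 := hQb 0
    rw [ha0] at h1
    rw [hb0] at h2
    exact ⟨J 0, htie 0, h1, h2⟩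

/-! ### Passing to the induced subgraph -/

namespace Link

variable {G : SimpleGraph V} {P Q : ℕ → V} {S : Set V} {P' Q' : ℕ → S}

/-- A link inside `S`, as a link of the subgraph induced by `S`. -/
def restrict (l : Link G P Q) (hS : ∀ v ∈ l.walk.support, v ∈ S)
    (hP : ∀ k, (P' k : V) ∈ range P) (hQ : ∀ k, (Q' k : V) ∈ range Q)
    (hx : ∃ k, G.Adj l.x (P' k)) (hy : ∃ k, G.Adj l.y (Q' k)) : Link (G.induce S) P' Q' where
  x := ⟨l.x, hS _ l.walk.start_mem_support⟩
  y := ⟨l.y, hS _ l.walk.end_mem_support⟩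
  walk := l.walk.induce S hS
  isPath := by
    refine SimpleGraph.Walk.IsPath.of_map (f := (SimpleGraph.Embedding.induce S).toHom) ?_
    rw [SimpleGraph.Walk.map_induce]
    exact l.isPath
  chordless := by
    intro u hu v hv h
    simp only [SimpleGraph.Walk.support_induce, List.mem_attachWith] at hu hv
    have he := l.chordless u hu v hv h
    have hmap := congrArg SimpleGraph.Walk.edges (SimpleGraph.Walk.map_induce l.walk hS)
    rw [SimpleGraph.Walk.edges_map] at hmap
    obtain ⟨e, he, heq⟩ := List.mem_map.mp ((congrArg (s((u : V), (v : V)) ∈ ·) hmap).mpr he)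
    have : e = s(u, v) := Sym2.map.injective Subtype.val_injective heq
    exact this ▸ he
  off_left := by
    rintro v hv ⟨k, rfl⟩
    simp only [SimpleGraph.Walk.support_induce, List.mem_attachWith] at hv
    exact l.off_left _ hv (hP k)
  off_right := by
    rintro v hv ⟨k, rfl⟩
    simp only [SimpleGraph.Walk.support_induce, List.mem_attachWith] at hv
    exact l.off_right _ hv (hQ k)
  adj_left := by
    intro v hv k h
    simp only [SimpleGraph.Walk.support_induce, List.mem_attachWith] at hv
    obtain ⟨i, hi⟩ := hP k
    exact Subtype.ext (l.adj_left v hv i (hi ▸ h))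
  adj_right := by
    intro v hv k h
    simp only [SimpleGraph.Walk.support_induce, List.mem_attachWith] at hv
    obtain ⟨i, hi⟩ := hQ k
    exact Subtype.ext (l.adj_right v hv i (hi ▸ h))
  exists_left := hx
  exists_right := hy

lemma mem_verts_restrict (l : Link G P Q) {hS : ∀ v ∈ l.walk.support, v ∈ S}
    {hP : ∀ k, (P' k : V) ∈ range P} {hQ : ∀ k, (Q' k : V) ∈ range Q}
    {hx : ∃ k, G.Adj l.x (P' k)} {hy : ∃ k, G.Adj l.y (Q' k)} {v : S} :
    v ∈ (l.restrict hS hP hQ hx hy).verts ↔ (v : V) ∈ l.verts := by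
  change v ∈ (l.walk.induce S hS).support ↔ _
  simp [verts]

end Link

/-- Two rays with a uniform sequence of independent links contain an induced ladder. -/
theorem exists_induced_tieLadder {G : SimpleGraph V} {P Q : ℕ → V} (hP : IsInducedRay G P)
    (hQ : IsInducedRay G Q) (hPQ : Disjoint (range P) (range Q))
    (hno : ∀ i j, ¬ G.Adj (P i) (Q j)) {L : ℕ → Link G P Q}
    (hL : ∀ m n, m < n → (L m).Before (L n)) {δ ε : ℕ}
    (hδ : AttachedAs G P (fun n => (L n).x) δ) (hε : AttachedAs G Q (fun n => (L n).y) ε) :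
    ∃ (S : Set V) (P' Q' : ℕ → S), (∀ i j, ¬ (G.induce S).Adj (P' i) (Q' j)) ∧
      IsTieLadder (G.induce S) P' Q' (IsLinkTie (G.induce S) P' Q' δ ε) := by
  choose a ha using hδ
  choose b hb using hε
  have hlt : ∀ n, a 0 ≤ a n ∧ b 0 ≤ b n := by
    intro n
    rcases Nat.eq_zero_or_pos n with rfl | hn
    · exact ⟨le_rfl, le_rfl⟩
    · exact ⟨((hL 0 n hn).2.1 _ _ ((ha 0 _).mpr (Or.inl rfl)) ((ha n _).mpr (Or.inl rfl))).le,
        ((hL 0 n hn).2.2 _ _ ((hb 0 _).mpr (Or.inl rfl)) ((hb n _).mpr (Or.inl rfl))).le⟩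
  -- The rails start at the first attachments of link 0, so that its tie contains both initial
  -- vertices; by `hlt` no later attachment is cut off.
  let S : Set V := range (fun k => P (a 0 + k)) ∪ range (fun k => Q (b 0 + k)) ∪
    ⋃ n, (L n).verts
  let P' : ℕ → S := fun k => ⟨P (a 0 + k), Or.inl (Or.inl ⟨k, rfl⟩)⟩
  let Q' : ℕ → S := fun k => ⟨Q (b 0 + k), Or.inl (Or.inr ⟨k, rfl⟩)⟩
  have hP' : IsInducedRay (G.induce S) P' := (hP.tail (a 0)).restrict
  have hQ' : IsInducedRay (G.induce S) Q' := (hQ.tail (b 0)).restrict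
  have hS : ∀ n, ∀ v ∈ (L n).walk.support, v ∈ S := fun n v hv => Or.inr (mem_iUnion.mpr ⟨n, hv⟩)
  have ha' : ∀ n k, G.Adj (L n).x (P' k) ↔ k = a n - a 0 ∨ k = a n - a 0 + δ := by
    intro n k
    refine (ha n (a 0 + k)).trans ?_
    have := hlt n
    omega
  have hb' : ∀ n k, G.Adj (L n).y (Q' k) ↔ k = b n - b 0 ∨ k = b n - b 0 + ε := by
    intro n k
    refine (hb n (b 0 + k)).trans ?_
    have := hlt n
    omega
  let L' : ℕ → Link (G.induce S) P' Q' := fun n => (L n).restrict (hS n) (fun k => ⟨_, rfl⟩)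
    (fun k => ⟨_, rfl⟩) ⟨_, (ha' n _).mpr (Or.inl rfl)⟩ ⟨_, (hb' n _).mpr (Or.inl rfl)⟩
  have hmem : ∀ n v, v ∈ (L' n).verts ↔ (v : V) ∈ (L n).verts := fun n v =>
    Link.mem_verts_restrict _
  have hL' : ∀ m n, m < n → (L' m).Before (L' n) := by
    intro m n hmn
    obtain ⟨h1, h2, h3⟩ := hL m n hmn
    refine ⟨fun u hu v hv => ?_, fun k k' h h' => ?_, fun k k' h h' => ?_⟩
    · rw [hmem] at hu hv
      exact ⟨fun e => (h1 u hu v hv).1 (congrArg Subtype.val e), (h1 u hu v hv).2⟩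
    · exact Nat.lt_of_add_lt_add_left (h2 _ _ h h')
    · exact Nat.lt_of_add_lt_add_left (h3 _ _ h h')
  refine ⟨S, P', Q', fun i j => hno _ _, isTieLadder_of_links hP' hQ' ?_ (fun i j => hno _ _) hL'
    (a := fun n => a n - a 0) (b := fun n => b n - b 0) ha' hb' (Nat.sub_self _)
    (Nat.sub_self _) ?_⟩
  · rw [disjoint_left]
    rintro _ ⟨i, rfl⟩ ⟨j, h⟩
    exact disjoint_left.mp hPQ ⟨_, rfl⟩ ⟨_, congrArg Subtype.val h⟩
  · rintro ⟨v, hv⟩ h1 h2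
    rcases hv with (⟨k, rfl⟩ | ⟨k, rfl⟩) | hv
    · exact (h1 ⟨k, rfl⟩).elim
    · exact (h2 ⟨k, rfl⟩).elim
    · obtain ⟨n, hn⟩ := mem_iUnion.mp hv
      exact ⟨n, (hmem n _).mpr hn⟩

/-- Two rays with a sequence of independent links, uniform at both ends, contain a member of one
of the three ladder families. -/
theorem exists_ladder_of_links {G : SimpleGraph V} {P Q : ℕ → V} (hP : IsInducedRay G P)
    (hQ : IsInducedRay G Q) (hPQ : Disjoint (range P) (range Q))
    (hno : ∀ i j, ¬ G.Adj (P i) (Q j)) {L : ℕ → Link G P Q}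
    (hL : ∀ m n, m < n → (L m).Before (L n)) {δ ε : ℕ} (hδ1 : δ ≤ 1) (hε1 : ε ≤ 1)
    (hδ : AttachedAs G P (fun n => (L n).x) δ) (hε : AttachedAs G Q (fun n => (L n).y) ε) :
    ∃ S : Set V, MemL (G.induce S) ∨ MemLDelta (G.induce S) ∨ MemLNablaDelta (G.induce S) := by
  -- Single attachments on `P` with double ones on `Q` are treated as type `Y` with the rays
  -- exchanged, so type `λ` never has to be verified.
  have hrev := exists_induced_tieLadder hQ hP hPQ.symm (fun i j h => hno _ _ h.symm)
    (L := fun n => (L n).reverse) (fun m n h => (hL m n h).reverse) hε hδ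
  obtain ⟨S, P', Q', hno', h⟩ := exists_induced_tieLadder hP hQ hPQ hno hL hδ hε
  interval_cases δ <;> interval_cases ε
  · exact ⟨S, Or.inl ⟨P', Q', h.imp fun J hJ => hJ.isTypeI h.1 h.2.1 h.2.2.1 hno'⟩⟩
  · obtain ⟨S, P', Q', hno', h⟩ := hrev
    exact ⟨S, Or.inr (Or.inl
      ⟨P', Q', Or.inl (h.imp fun J hJ => hJ.isTypeY h.1 h.2.1 h.2.2.1 hno')⟩)⟩
  · exact ⟨S, Or.inr (Or.inl
      ⟨P', Q', Or.inl (h.imp fun J hJ => hJ.isTypeY h.1 h.2.1 h.2.2.1 hno')⟩)⟩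
  · exact ⟨S, Or.inr (Or.inr
      ⟨P', Q', h.imp fun J hJ => hJ.isTypeYLambda h.1 h.2.1 h.2.2.1 hno'⟩)⟩

/-- Linked disjoint induced rays in a locally finite graph lead to an induced ladder. -/
theorem exists_ladder_of_linked {G : SimpleGraph V} (hG : IsLocallyFinite G) {P Q : ℕ → V}
    (hP : IsInducedRay G P) (hQ : IsInducedRay G Q) (hPQ : Disjoint (range P) (range Q))
    (hl : Linked G P Q) :
    (∃ S : Set V, IsMessyLadder (G.induce S)) ∨
    ∃ S : Set V, MemL (G.induce S) ∨ MemLDelta (G.induce S) ∨ MemLNablaDelta (G.induce S) := by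
  by_cases hinf : {i | ∃ j, G.Adj (P i) (Q j)}.Infinite
  · exact Or.inl (exists_messyLadder hG hP hQ hPQ hinf)
  obtain ⟨N, hN⟩ := (not_infinite.mp hinf).bddAbove
  have hP₁ := hP.tail (N + 1)
  have hPQ₁ : Disjoint (range fun i => P (N + 1 + i)) (range Q) :=
    hPQ.mono_left (by rintro _ ⟨i, rfl⟩; exact ⟨_, rfl⟩)
  have hno₁ : ∀ i j, ¬ G.Adj (P (N + 1 + i)) (Q j) := by
    intro i j h
    have : N + 1 + i ≤ N := hN ⟨j, h⟩
    omega
  have hl₁ : Linked G (fun i => P (N + 1 + i)) Q := by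
    intro F hF
    -- Adding the deleted segment of `P` to the forbidden set forces the walk to start on the
    -- remaining tail.
    obtain ⟨i, j, w, hw⟩ := hl (F ∪ P '' {k | k < N + 1})
      (hF.union ((finite_lt_nat _).image P))
    have hi : N + 1 ≤ i := not_lt.mp fun h => hw _ w.start_mem_support (Or.inr ⟨i, h, rfl⟩)
    obtain ⟨k, rfl⟩ := Nat.exists_eq_add_of_le hi
    exact ⟨k, j, w, fun v hv hvF => hw v hv (Or.inl hvF)⟩
  obtain ⟨L, hL⟩ := exists_link_sequence hG hP₁.1.1 hQ.1.1 hPQ₁ hno₁ hl₁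
  rcases exists_uniform_left hG hP₁ hQ hPQ₁ hno₁ hL with h |
    ⟨P₂, L₂, -, δ, hP₂, hPQ₂, hno₂, hL₂, -, hδ1, hδ⟩
  · exact Or.inl h
  -- The second round works at `Q` on reversed links. It passes to a subsequence and keeps the ends
  -- at `P₂`, so the uniform attachment there survives.
  rcases exists_uniform_left hG hQ hP₂ hPQ₂.symm (fun i j h => hno₂ _ _ h.symm)
      (L := fun n => (L₂ n).reverse) (fun m n h => (hL₂ m n h).reverse) with h |
    ⟨Q₃, L₃, φ, ε, hQ₃, hPQ₃, hno₃, hL₃, hy, hε1, hε⟩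
  · exact Or.inl h
  refine Or.inr (exists_ladder_of_links hQ₃ hP₂ hPQ₃ hno₃ hL₃ hε1 hδ1 hε fun n => ?_)
  obtain ⟨a, ha⟩ := hδ (φ n)
  exact ⟨a, fun k => by dsimp only; rw [hy n]; exact ha k⟩

end LadderLemma

theorem lemma3p9 {V : Type*} [Infinite V] (G : SimpleGraph V)
    (hlf : LadderLemma.IsLocallyFinite G) (h2 : LadderLemma.IsTwoConnected G) :
    ∃ S : Set V,
      LadderLemma.IsMessyLadder (G.induce S) ∨
      LadderLemma.MemL (G.induce S) ∨
      LadderLemma.MemLDelta (G.induce S) ∨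
      LadderLemma.MemLNablaDelta (G.induce S) := by
  obtain ⟨A, B, hA, hB, hAB, hinf⟩ := LadderLemma.exists_infinite_bond hlf h2
  obtain ⟨P, Q, hP, hQ, hPQ, hl⟩ := LadderLemma.exists_linked_rays hlf hA hB hAB hinf
  rcases LadderLemma.exists_ladder_of_linked hlf hP hQ hPQ hl with ⟨S, h⟩ | ⟨S, h⟩
  exacts [⟨S, Or.inl h⟩, ⟨S, Or.inr h⟩]
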